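/- Let $d\in\mathbb{N}$, $\lambda>0$, $\delta>0$, and let $f:\mathbb{R}^d\to\mathbb{R}$ be continuous, attain its minimum, and satisfy $\int_{\mathbb{R}^d} e^{-f(y)/\delta}\,dy<\infty$. Define \[ f^{\lambda,\delta}(x)=-\delta\log \mathbb{E}_{y\sim\mathcal N(x,\lambda\delta I)}\big[e^{-f(y)/\delta}\big], \qquad \operatorname{zprox}^{\delta}_{\lambda,f}(x)=\frac{\mathbb{E}_{y\sim\mathcal N(x,\lambda\delta I)}\big[y\,e^{-f(y)/\delta}\big]}{\mathbb{E}_{y\sim\mathcal N(x,\lambda\delta I)}\big[e^{-f(y)/\delta}\big]}, \] and $X^\star_{\lambda,\delta}=\operatorname{argmin} f^{\lambda,\delta}$. Suppose that at least one of the following holds: (a) $f$ is convex; or (b) $f(y)=\frac{\kappa}{2}\|y\|^2+V(y)$ for all $y$, for some $\kappa>0$ and some bounded $V:\mathbb{R}^d\to\mathbb{R}$ such that, with $\operatorname{osc}(V)=\sup V-\inf V$, \[ \lambda\ \ge\ \frac{e^{\operatorname{osc}(V)/\delta}-1}{\kappa}. \] Then: 1. There is a convex function $H:\mathbb{R}^d\to\mathbb{R}$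 such that $\operatorname{zprox}^{\delta}_{\lambda,f}=\operatorname{prox}_{\lambda\delta H}$, that is, for every $x$ the point $\operatorname{zprox}^{\delta}_{\lambda,f}(x)$ is the unique minimizer of $y\mapsto H(y)+\frac{1}{2\lambda\delta}\|x-y\|^2$. 2. $\operatorname{zprox}^{\delta}_{\lambda,f}$ is firmly nonexpansive: writing $T=\operatorname{zprox}^{\delta}_{\lambda,f}$, one has $\|Tx-Ty\|^2+\|(x-Tx)-(y-Ty)\|^2\le\|x-y\|^2$ for all $x,y$. 3. The function $f^{\lambda,\delta}$ is differentiable and, for every $x^0\in\mathbb{R}^d$, the sequence defined by $x^{k+1}=\operatorname{zprox}^{\delta}_{\lambda,f}(x^k)$ converges to some point of $X^\star_{\lambda,\delta}$ (in particular this set is nonempty), and for every $k\ge 1$ \[ f^{\lambda,\delta}(x^k)-\min f^{\lambda,\delta}\le\frac{\operatorname{dist}(x^0,X^\star_{\lambda,\delta})^2}{2\lambda k}, \qquad \|\nabla f^{\lambda,\delta}(x^k)\|\le\frac{2\operatorname{dist}(x^0,X^\star_{\lambda,\delta})}{\lambda(k+1)}. \] -/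

import Mathlib

namespace ZerothOrderProx

/-- The space `ℝ^d` with its Euclidean norm. -/
abbrev Space (d : ℕ) : Type := EuclideanSpace ℝ (Fin d)

/-- The standing assumption on the objective `f` at temperature `δ`: `f` is continuous and attains
its minimum, and `exp (-f / δ)` is Lebesgue integrable on `ℝ^d`. -/
structure StandingAssumption {d : ℕ} (f : Space d → ℝ) (δ : ℝ) : Prop where
  continuous : Continuous f
  exists_minimizer : ∃ m, ∀ y, f m ≤ f y
  integrable : MeasureTheory.Integrable (fun y => Real.exp (-f y / δ)) MeasureTheory.volume

/-- The isotropic Gaussian distribution `𝒩(x, s I)` on `ℝ^d`. -/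
noncomputable def isoGaussian {d : ℕ} (x : Space d) (s : ℝ) : MeasureTheory.Measure (Space d) :=
  ProbabilityTheory.multivariateGaussian x (s • (1 : Matrix (Fin d) (Fin d) ℝ))

/-- The soft Moreau envelope
`f^{λ,δ}(x) = -δ log 𝔼_{y ∼ 𝒩(x, λ δ I)} [exp (-f(y) / δ)]`. -/
noncomputable def softMoreau {d : ℕ} (lam δ : ℝ) (f : Space d → ℝ) (x : Space d) : ℝ :=
  -δ * Real.log (∫ y, Real.exp (-f y / δ) ∂(isoGaussian x (lam * δ)))

/-- The zeroth-order proximal operator: `𝔼 [y exp (-f(y) / δ)] / 𝔼 [exp (-f(y) / δ)]` with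
`y ∼ 𝒩(x, λ δ I)`. -/
noncomputable def zprox {d : ℕ} (lam δ : ℝ) (f : Space d → ℝ) (x : Space d) : Space d :=
  (∫ y, Real.exp (-f y / δ) ∂(isoGaussian x (lam * δ)))⁻¹ •
    ∫ y, Real.exp (-f y / δ) • y ∂(isoGaussian x (lam * δ))

/-- The set of global minimizers of `F`. -/
def argminSet {d : ℕ} (F : Space d → ℝ) : Set (Space d) :=
  {x | ∀ y, F x ≤ F y}

/-- The set `prox_{γ g}(x)` of global minimizers of `y ↦ g(y) + ‖x - y‖² / (2 γ)`; the operator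
`prox_{γ g}` takes the value `p` at `x` when this set is `{p}`. -/
noncomputable def proxSet {d : ℕ} (γ : ℝ) (g : Space d → ℝ) (x : Space d) : Set (Space d) :=
  argminSet fun y => g y + 1 / (2 * γ) * ‖x - y‖ ^ 2

/-- Firm nonexpansiveness: `‖T x - T y‖² + ‖(x - T x) - (y - T y)‖² ≤ ‖x - y‖²`. -/
def FirmlyNonexpansive {d : ℕ} (T : Space d → Space d) : Prop :=
  ∀ x y, ‖T x - T y‖ ^ 2 + ‖(x - T x) - (y - T y)‖ ^ 2 ≤ ‖x - y‖ ^ 2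

/-- The global oscillation `sup V - inf V` (meaningful for bounded `V`). -/
noncomputable def osc {d : ℕ} (V : Space d → ℝ) : ℝ :=
  (⨆ y, V y) - ⨅ y, V y

/-- The bounded-oscillation conditions: `f(y) = κ/2 ‖y‖² + V(y)` with `κ > 0`, `V` bounded, and
`λ ≥ (exp (osc V / δ) - 1) / κ`. -/
def BoundedOscillation {d : ℕ} (lam δ : ℝ) (f : Space d → ℝ) : Prop :=
  ∃ (κ : ℝ) (V : Space d → ℝ), 0 < κ ∧ (∀ y, f y = κ / 2 * ‖y‖ ^ 2 + V y) ∧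
    BddAbove (Set.range V) ∧ BddBelow (Set.range V) ∧
    (Real.exp (osc V / δ) - 1) / κ ≤ lam

end ZerothOrderProx

/-! ### Density of the isotropic Gaussian -/

namespace ZerothOrderProx

/-! Put `s = lam * δ`, `w = exp (-f / δ)`, and let `G = -s log ∫ exp (-‖y - x‖² / (2 s)) w y dy` be
`heatPotential s w`. Up to an additive constant the soft Moreau envelope is `lam⁻¹ * G`, and `zprox`
is the barycenter `T = heatMean s w`. Everything follows from two facts about `G`.

The first, `heatPotential_le`, holds for every positive integrable weight: `‖x‖² / 2 - G x` is, up
to a constant, `s` times the logarithm of a Laplace transform, hence convex with subgradient `T x`.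
So `G` has a quadratic upper model at every `x`, with slope `x - T x` and curvature 1.

The second is convexity of `G`, the only place where the two cases differ. For convex `f` it is the
Prékopa–Leindler inequality. For a bounded perturbation of a quadratic, the second derivative of `G`
along a line is `‖u‖²` minus a rescaled variance, and comparison with an exact Gaussian bounds that
variance.

Thus `G` is convex and 1-smooth with gradient `x - T x`, and `T` is a unit gradient step.
Cocoercivity of the gradient gives firm nonexpansiveness. The function `deconv G` has `G` as its
Moreau envelope and `T` as its proximal map. The rates and the convergence are those of gradient
descent: telescoping sums and Fejér monotonicity. -/

open MeasureTheory ProbabilityTheory Real Complex in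
theorem isoGaussian_eq_withDensity {d : ℕ} (x : Space d) {s : ℝ} (hs : 0 < s) :
    isoGaussian x s = volume.withDensity (fun y : Space d =>
      ENNReal.ofReal (((2 * π * s) ^ ((d : ℝ) / 2))⁻¹ * Real.exp (-‖y - x‖ ^ 2 / (2 * s)))) := by
  set c : ℝ := ((2 * π * s) ^ ((d : ℝ) / 2))⁻¹ with hc
  have hc0 : 0 < c := by positivity
  have hb : 0 < (((2 * s)⁻¹ : ℝ) : ℂ).re := by
    rw [Complex.ofReal_re]; positivity
  have hint : Integrable (fun y : Space d => Real.exp (-‖y - x‖ ^ 2 / (2 * s))) := by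
    have := (GaussianFourier.integrable_cexp_neg_mul_sq_norm_add (V := Space d) hb 0 0).re
    have h2 := this.comp_sub_right x
    refine h2.congr (.of_forall fun y => ?_)
    simp only [zero_mul, add_zero]
    rw [show -(((2 * s)⁻¹ : ℝ) : ℂ) * ((‖y - x‖ : ℝ) : ℂ) ^ 2
      = ((-‖y - x‖ ^ 2 / (2 * s) : ℝ) : ℂ) by push_cast; ring]
    exact Complex.exp_ofReal_re _
  have : IsFiniteMeasure (volume.withDensity (fun y : Space d =>
      ENNReal.ofReal (c * Real.exp (-‖y - x‖ ^ 2 / (2 * s))))) :=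
    isFiniteMeasure_withDensity_ofReal (hint.const_mul c).2
  have : IsProbabilityMeasure (isoGaussian x s) := by unfold isoGaussian; infer_instance
  -- Both measures are finite, so it suffices to match characteristic functions; the density side is
  -- a Gaussian Fourier integral after translating by `x`.
  refine Measure.ext_of_charFun ?_
  ext t
  have hS : (s • (1 : Matrix (Fin d) (Fin d) ℝ)).PosSemidef :=
    Matrix.PosSemidef.one.smul hs.le
  rw [isoGaussian, charFun_multivariateGaussian hS, charFun_apply,
    integral_withDensity_eq_integral_toReal_smul (by fun_prop)
      (.of_forall fun _ => ENNReal.ofReal_lt_top)]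
  have h1 : ∀ y : Space d,
      (ENNReal.ofReal (c * Real.exp (-‖y - x‖ ^ 2 / (2 * s)))).toReal • cexp (inner ℝ y t * I) =
      (fun z : Space d => (c : ℂ) * cexp (inner ℝ t x * I) *
        cexp (-(((2 * s)⁻¹ : ℝ) : ℂ) * ‖z‖ ^ 2 + I * inner ℝ t z)) (y - x) := by
    intro y
    rw [ENNReal.toReal_ofReal (by positivity)]
    simp only [Complex.real_smul]
    push_cast
    rw [mul_assoc, mul_assoc, ← Complex.exp_add, ← Complex.exp_add, inner_sub_right, real_inner_comm]
    congr 2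
    push_cast
    ring
  rw [integral_congr_ae (.of_forall h1), integral_sub_right_eq_self (μ := volume)
      (fun z : Space d => (c : ℂ) * cexp (inner ℝ t x * I) *
        cexp (-(((2 * s)⁻¹ : ℝ) : ℂ) * ‖z‖ ^ 2 + I * inner ℝ t z)) x, integral_const_mul,
    GaussianFourier.integral_cexp_neg_mul_sq_norm_add hb]
  have h2 : ((π : ℂ) / (((2 * s)⁻¹ : ℝ) : ℂ)) ^ ((Module.finrank ℝ (Space d) : ℂ) / 2) =
      ((((2 * π * s) ^ ((d : ℝ) / 2)) : ℝ) : ℂ) := by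
    rw [Complex.ofReal_cpow (by positivity), finrank_euclideanSpace_fin]
    push_cast
    congr 1
    field_simp
  rw [h2]
  have h3 : (c : ℂ) * (((2 * π * s) ^ ((d : ℝ) / 2) : ℝ) : ℂ) = 1 := by
    rw [← Complex.ofReal_mul, hc, inv_mul_cancel₀ (by positivity), Complex.ofReal_one]
  have h4 : (WithLp.ofLp t ⬝ᵥ (s • (1 : Matrix (Fin d) (Fin d) ℝ)).mulVec
      (WithLp.ofLp t)) = s * ‖t‖ ^ 2 := by
    rw [Matrix.smul_mulVec, Matrix.one_mulVec, dotProduct_smul, EuclideanSpace.norm_sq_eq]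
    simp [dotProduct, sq]
  rw [h4, Complex.exp_sub, mul_assoc, mul_left_comm, ← mul_assoc (c : ℂ),
    ← mul_assoc, mul_comm (cexp _) ((c : ℂ) * _), h3, one_mul,
    div_eq_mul_inv, ← Complex.exp_neg]
  congr 2
  have hs' : (s : ℂ) ≠ 0 := by exact_mod_cast hs.ne'
  simp
  field_simp
  norm_num

open MeasureTheory in
theorem integral_isoGaussian {d : ℕ} {E : Type*} [NormedAddCommGroup E] [NormedSpace ℝ E]
    (x : Space d) {s : ℝ} (hs : 0 < s) (g : Space d → E) :
    ∫ y, g y ∂(isoGaussian x s) =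
      ((2 * Real.pi * s) ^ ((d : ℝ) / 2))⁻¹ • ∫ y, Real.exp (-‖y - x‖ ^ 2 / (2 * s)) • g y := by
  rw [isoGaussian_eq_withDensity x hs, integral_withDensity_eq_integral_toReal_smul (by fun_prop)
      (.of_forall fun _ => ENNReal.ofReal_lt_top), ← integral_smul]
  refine integral_congr_ae (.of_forall fun y => ?_)
  simp only []
  rw [ENNReal.toReal_ofReal (by positivity), mul_smul]

/-! ### Convex 1-smooth functions: gradient, proximal representation, cocoercivity -/

section Deconvolution

variable {d : ℕ} {G : Space d → ℝ} {T : Space d → Space d}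

/-- A convex function with a global quadratic upper bound at `x` of slope `x - T x` lies above the
corresponding affine function. -/
theorem affine_le_of_convexOn (hG : ConvexOn ℝ Set.univ G)
    (hT : ∀ x y, G y ≤ G x + inner ℝ (x - T x) (y - x) + ‖y - x‖ ^ 2 / 2) (x y : Space d) :
    G x + inner ℝ (x - T x) (y - x) ≤ G y := by
  set h := y - x with hh
  -- Step backwards: `x` lies between `x - t • h` and `y`, and the upper model controls `G (x - t •
  -- h)` up to `t² ‖h‖² / 2`. Dividing by `t` leaves an error that vanishes with `t`.
  have key : ∀ t : ℝ, 0 < t → t ≤ 1 →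
      G x + inner ℝ (x - T x) h - G y ≤ t * (‖h‖ ^ 2 / 2) := by
    intro t ht ht1
    have h1 := hT x (x - t • h)
    have h2 := hG.2 (Set.mem_univ (x - t • h)) (Set.mem_univ y)
      (show (0 : ℝ) ≤ 1 / (1 + t) by positivity) (show (0 : ℝ) ≤ t / (1 + t) by positivity)
      (by field_simp)
    have h3 : (1 / (1 + t)) • (x - t • h) + (t / (1 + t)) • y = x := by
      have hy : y = x + h := by rw [hh]; abel
      rw [hy]
      have : (1 / (1 + t)) • (x - t • h) + (t / (1 + t)) • (x + h)
        = (1 / (1 + t) + t / (1 + t)) • x + (t / (1 + t) - 1 / (1 + t) * t) • h := by module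
      rw [this]
      have e1 : 1 / (1 + t) + t / (1 + t) = 1 := by field_simp
      have e2 : t / (1 + t) - 1 / (1 + t) * t = 0 := by ring
      rw [e1, e2]; simp
    rw [h3] at h2
    have h4 : x - t • h - x = -(t • h) := by abel
    rw [h4, inner_neg_right, inner_smul_right, norm_neg, norm_smul, Real.norm_eq_abs,
      abs_of_pos ht] at h1
    have h5 : (1 + t) * G x ≤ G (x - t • h) + t * G y := by
      have : G x ≤ (G (x - t • h) + t * G y) / (1 + t) := by
        refine h2.trans (le_of_eq ?_)
        simp only [smul_eq_mul]; ring
      rwa [le_div_iff₀ (by positivity), mul_comm] at this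
    have h6 : t * (G x + inner ℝ (x - T x) h - G y) ≤ t * (t * (‖h‖ ^ 2 / 2)) := by
      nlinarith
    exact le_of_mul_le_mul_left h6 ht
  have hlim : Filter.Tendsto (fun t : ℝ => t * (‖h‖ ^ 2 / 2)) (nhdsWithin 0 (Set.Ioi 0))
      (nhds 0) := by
    have : Filter.Tendsto (fun t : ℝ => t * (‖h‖ ^ 2 / 2)) (nhds 0) (nhds (0 * (‖h‖ ^ 2 / 2))) :=
      (continuous_id.mul continuous_const).tendsto 0
    rw [zero_mul] at this
    exact this.mono_left nhdsWithin_le_nhds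
  have := ge_of_tendsto hlim (b := G x + inner ℝ (x - T x) h - G y) (by
    filter_upwards [Ioo_mem_nhdsGT (zero_lt_one' ℝ)] with t ht using key t ht.1 ht.2.le)
  linarith

/-- `G` is squeezed between an affine function and the same function plus `‖y - x‖² / 2`, so no
differentiation under the integral is needed. -/
theorem hasGradientAt_of_convexOn (hG : ConvexOn ℝ Set.univ G)
    (hT : ∀ x y, G y ≤ G x + inner ℝ (x - T x) (y - x) + ‖y - x‖ ^ 2 / 2) (x : Space d) :
    HasGradientAt G (x - T x) x := by
  rw [hasGradientAt_iff_isLittleO]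
  refine Asymptotics.IsBigO.trans_isLittleO (g := fun y => ‖y - x‖ ^ 2) ?_ ?_
  · refine Asymptotics.IsBigO.of_bound 1 (.of_forall fun y => ?_)
    have h1 := hT x y
    have h2 := affine_le_of_convexOn hG hT x y
    rw [Real.norm_eq_abs, Real.norm_eq_abs, abs_of_nonneg (by linarith),
      abs_of_nonneg (by positivity)]
    nlinarith [sq_nonneg ‖y - x‖]
  · have := Asymptotics.isLittleO_norm_pow_id (E' := Space d) one_lt_two
    have h2 : Filter.Tendsto (fun y : Space d => y - x) (nhds x) (nhds 0) := by
      rw [← sub_self x]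
      exact (continuous_id.sub continuous_const).tendsto x
    exact this.comp_tendsto h2

/-- The convex function whose proximal operator is `T`. -/
noncomputable def deconv (G : Space d → ℝ) (p : Space d) : ℝ :=
  ⨆ z, (G (p + z) - ‖z‖ ^ 2 / 2)

/-- Finiteness has to be secured: an unbounded real `⨆` would silently be 0. -/
theorem bddAbove_deconv (hB : ∀ p, ∃ C, ∀ x, G x - ‖x - p‖ ^ 2 / 2 ≤ C) (p : Space d) :
    BddAbove (Set.range fun z => G (p + z) - ‖z‖ ^ 2 / 2) := by
  obtain ⟨C, hC⟩ := hB p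
  refine ⟨C, ?_⟩
  rintro _ ⟨z, rfl⟩
  simpa using hC (p + z)

/-- With the supremum taken over the displacement `z`, the quadratic term does not involve `p`, so
this is a supremum of translates of `G` minus constants. -/
theorem convexOn_deconv (hG : ConvexOn ℝ Set.univ G)
    (hB : ∀ p, ∃ C, ∀ x, G x - ‖x - p‖ ^ 2 / 2 ≤ C) : ConvexOn ℝ Set.univ (deconv G) := by
  refine ⟨convex_univ, fun p _ q _ a b ha hb hab => ciSup_le fun z => ?_⟩
  have h1 := hG.2 (Set.mem_univ (p + z)) (Set.mem_univ (q + z)) ha hb hab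
  have h2 : a • (p + z) + b • (q + z) = a • p + b • q + z := by
    rw [smul_add, smul_add, add_add_add_comm, ← add_smul, hab, one_smul]
  rw [h2] at h1
  have h3 := le_ciSup (bddAbove_deconv hB p) z
  have h4 := le_ciSup (bddAbove_deconv hB q) z
  simp only [smul_eq_mul] at h1 ⊢
  unfold deconv
  calc G (a • p + b • q + z) - ‖z‖ ^ 2 / 2
      ≤ a * (G (p + z) - ‖z‖ ^ 2 / 2) + b * (G (q + z) - ‖z‖ ^ 2 / 2) := by
        have : ‖z‖ ^ 2 / 2 = a * (‖z‖ ^ 2 / 2) + b * (‖z‖ ^ 2 / 2) := by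
          rw [← add_mul, hab, one_mul]
        linarith
    _ ≤ _ := add_le_add (mul_le_mul_of_nonneg_left h3 ha) (mul_le_mul_of_nonneg_left h4 hb)

theorem le_deconv_add (hB : ∀ p, ∃ C, ∀ x, G x - ‖x - p‖ ^ 2 / 2 ≤ C) (x y : Space d) :
    G x ≤ deconv G y + ‖x - y‖ ^ 2 / 2 := by
  have := le_ciSup (bddAbove_deconv hB y) (x - y)
  simp only [add_sub_cancel] at this
  unfold deconv
  linarith

/-- At `T x + z` the upper model around `x` equals `G x - ‖x - T x‖² / 2 + ‖z‖² / 2`, so the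
supremum defining `deconv G (T x)` is attained at `z = x - T x`. -/
theorem deconv_add_eq (hT : ∀ x y, G y ≤ G x + inner ℝ (x - T x) (y - x) + ‖y - x‖ ^ 2 / 2)
    (hB : ∀ p, ∃ C, ∀ x, G x - ‖x - p‖ ^ 2 / 2 ≤ C) (x : Space d) :
    deconv G (T x) + ‖x - T x‖ ^ 2 / 2 = G x := by
  refine le_antisymm ?_ (le_deconv_add hB x (T x))
  suffices deconv G (T x) ≤ G x - ‖x - T x‖ ^ 2 / 2 by linarith
  refine ciSup_le fun z => ?_
  have h1 := hT x (T x + z)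
  have h2 : T x + z - x = z - (x - T x) := by abel
  rw [h2, inner_sub_right, real_inner_self_eq_norm_sq, norm_sub_sq_real z,
    real_inner_comm z] at h1
  linarith

theorem proxSet_deconv {s : ℝ} (hs : 0 < s) (hG : ConvexOn ℝ Set.univ G)
    (hT : ∀ x y, G y ≤ G x + inner ℝ (x - T x) (y - x) + ‖y - x‖ ^ 2 / 2)
    (hB : ∀ p, ∃ C, ∀ x, G x - ‖x - p‖ ^ 2 / 2 ≤ C) (x : Space d) :
    proxSet s (fun p => s⁻¹ * deconv G p) x = {T x} := by
  have hval : ∀ y, s⁻¹ * deconv G y + 1 / (2 * s) * ‖x - y‖ ^ 2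
      = s⁻¹ * (deconv G y + ‖x - y‖ ^ 2 / 2) := by
    intro y; field_simp
  ext y
  simp only [proxSet, argminSet, Set.mem_ofPred_eq, Set.mem_singleton_iff, hval]
  have hs' : 0 < s⁻¹ := inv_pos.2 hs
  constructor
  · intro h
    have h1 := le_of_mul_le_mul_left (h (T x)) hs'
    rw [deconv_add_eq hT hB] at h1
    -- Uniqueness: if `y` is also a minimizer, the midpoint does strictly better by the
    -- parallelogram law unless `y = T x`.
    have h2 := (convexOn_deconv hG hB).2 (Set.mem_univ y) (Set.mem_univ (T x))
      (show (0 : ℝ) ≤ 1 / 2 by norm_num) (show (0 : ℝ) ≤ 1 / 2 by norm_num) (by norm_num)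
    have h3 := le_deconv_add hB x ((1 / 2 : ℝ) • y + (1 / 2 : ℝ) • T x)
    have h4 := deconv_add_eq hT hB x
    have h5 : x - ((1 / 2 : ℝ) • y + (1 / 2 : ℝ) • T x)
        = (1 / 2 : ℝ) • ((x - y) + (x - T x)) := by module
    have h6 := parallelogram_law_with_norm ℝ (x - y) (x - T x)
    rw [h5, norm_smul, mul_pow] at h3
    have h7 : (x - y) - (x - T x) = T x - y := by abel
    rw [h7] at h6
    simp only [smul_eq_mul] at h2
    norm_num at h3
    have h8 : ‖T x - y‖ ^ 2 ≤ 0 := by nlinarith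
    have h9 : ‖T x - y‖ = 0 := by nlinarith [norm_nonneg (T x - y)]
    exact (sub_eq_zero.1 (norm_eq_zero.1 h9)).symm
  · rintro rfl z
    refine mul_le_mul_of_nonneg_left ?_ hs'.le
    rw [deconv_add_eq hT hB]
    exact le_deconv_add hB x z

theorem firmlyNonexpansive_of_convexOn (hG : ConvexOn ℝ Set.univ G)
    (hT : ∀ x y, G y ≤ G x + inner ℝ (x - T x) (y - x) + ‖y - x‖ ^ 2 / 2) :
    FirmlyNonexpansive T := by
  have key : ∀ x y, G x + inner ℝ (x - T x) (y - x) + ‖(x - T x) - (y - T y)‖ ^ 2 / 2 ≤ G y := by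
    intro x y
    -- The test point `y - (v - u)`, where `u = x - T x` and `v = y - T y`, is the unit gradient
    -- step from `y` for `G - ⟨u, ·⟩`. Comparing the lower bound from `x` with the upper model from
    -- `y` gains `‖u - v‖² / 2`; adding the symmetric inequality gives cocoercivity.
    have h1 := affine_le_of_convexOn hG hT x (T y + (x - T x))
    have h2 := hT y (T y + (x - T x))
    set u := x - T x with hu
    set v := y - T y with hv
    have e1 : T y + u - x = (y - x) + (u - v) := by rw [hv]; abel
    have e2 : T y + u - y = u - v := by rw [hv]; abel
    rw [e1, inner_add_right] at h1
    rw [e2] at h2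
    have e3 : inner ℝ u (u - v) - inner ℝ v (u - v) = ‖u - v‖ ^ 2 := by
      rw [← inner_sub_left, real_inner_self_eq_norm_sq]
    linarith
  intro x y
  have h1 := key x y
  have h2 := key y x
  set u := x - T x with hu
  set v := y - T y with hv
  have e0 : ‖v - u‖ = ‖u - v‖ := norm_sub_rev _ _
  have e1 : T x - T y = (x - y) - (u - v) := by rw [hu, hv]; abel
  have e2 : inner ℝ u (y - x) = - inner ℝ u (x - y) := by rw [← inner_neg_right, neg_sub]
  have e3 : inner ℝ (x - y) (u - v) = inner ℝ u (x - y) - inner ℝ v (x - y) := by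
    rw [real_inner_comm, inner_sub_left]
  rw [e1, norm_sub_sq_real, e3]
  rw [e0] at h2
  linarith

end Deconvolution

/-! ### Gradient descent on a convex 1-smooth function -/

section Iteration

variable {d : ℕ} {G : Space d → ℝ} {T : Space d → Space d}

theorem FirmlyNonexpansive.norm_sub_le (hT : FirmlyNonexpansive T) (x y : Space d) :
    ‖T x - T y‖ ≤ ‖x - y‖ := by
  have := hT x y
  exact le_of_sq_le_sq (by nlinarith [sq_nonneg ‖(x - T x) - (y - T y)‖]) (norm_nonneg _)

theorem norm_residual_antitone (hT : FirmlyNonexpansive T) {x : ℕ → Space d}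
    (hx : ∀ k, x (k + 1) = T (x k)) : Antitone fun k => ‖x k - T (x k)‖ := by
  refine antitone_nat_of_succ_le fun k => ?_
  have := hT.norm_sub_le (x k) (x (k + 1))
  rwa [← hx k] at this ⊢

/-- A unit gradient step lowers `G` by at least `‖p - T p‖² / 2`, which is impossible at a minimizer
unless the step is zero. -/
theorem eq_of_mem_argminSet
    (hT : ∀ x y, G y ≤ G x + inner ℝ (x - T x) (y - x) + ‖y - x‖ ^ 2 / 2) {p : Space d}
    (hp : p ∈ argminSet G) : T p = p := by
  have h1 := hT p (T p)
  have h2 := hp (T p)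
  have h3 : T p - p = -(p - T p) := by abel
  rw [h3, inner_neg_right, real_inner_self_eq_norm_sq, norm_neg] at h1
  have h9 : ‖p - T p‖ = 0 := by nlinarith [norm_nonneg (p - T p)]
  exact (sub_eq_zero.1 (norm_eq_zero.1 h9)).symm

theorem descent (hT : ∀ x y, G y ≤ G x + inner ℝ (x - T x) (y - x) + ‖y - x‖ ^ 2 / 2)
    (x : Space d) : G (T x) + ‖x - T x‖ ^ 2 / 2 ≤ G x := by
  have h1 := hT x (T x)
  have h3 : T x - x = -(x - T x) := by abel
  rw [h3, inner_neg_right, real_inner_self_eq_norm_sq, norm_neg] at h1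
  linarith

/-- Descent and the tangent bound at `x` combine by completing the square; the right side telescopes
along the iteration. -/
theorem three_point (hG : ConvexOn ℝ Set.univ G)
    (hT : ∀ x y, G y ≤ G x + inner ℝ (x - T x) (y - x) + ‖y - x‖ ^ 2 / 2) (x p : Space d) :
    G (T x) - G p ≤ (‖x - p‖ ^ 2 - ‖T x - p‖ ^ 2) / 2 := by
  have h1 := descent hT x
  have h2 := affine_le_of_convexOn hG hT x p
  have e1 : T x - p = (x - p) - (x - T x) := by abel
  have e2 : inner ℝ (x - T x) (p - x) = - inner ℝ (x - T x) (x - p) := by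
    rw [← inner_neg_right, neg_sub]
  rw [e1, norm_sub_sq_real (x - p), real_inner_comm]
  linarith

theorem sum_gap_le (hG : ConvexOn ℝ Set.univ G)
    (hT : ∀ x y, G y ≤ G x + inner ℝ (x - T x) (y - x) + ‖y - x‖ ^ 2 / 2) {x : ℕ → Space d}
    (hx : ∀ k, x (k + 1) = T (x k)) (p : Space d) (k : ℕ) :
    ∑ j ∈ Finset.range k, (G (x (j + 1)) - G p) ≤ (‖x 0 - p‖ ^ 2 - ‖x k - p‖ ^ 2) / 2 := by
  induction k with
  | zero => simp
  | succ k ih =>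
    rw [Finset.sum_range_succ]
    have := three_point hG hT (x k) p
    rw [← hx k] at this
    linarith

theorem antitone_values (hT : ∀ x y, G y ≤ G x + inner ℝ (x - T x) (y - x) + ‖y - x‖ ^ 2 / 2)
    {x : ℕ → Space d} (hx : ∀ k, x (k + 1) = T (x k)) : Antitone fun k => G (x k) := by
  refine antitone_nat_of_succ_le fun k => ?_
  have := descent hT (x k)
  rw [← hx k] at this
  nlinarith [sq_nonneg ‖x k - x (k + 1)‖]

theorem gap_le (hG : ConvexOn ℝ Set.univ G)
    (hT : ∀ x y, G y ≤ G x + inner ℝ (x - T x) (y - x) + ‖y - x‖ ^ 2 / 2) {x : ℕ → Space d}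
    (hx : ∀ k, x (k + 1) = T (x k)) (p : Space d) (k : ℕ) :
    k * (G (x k) - G p) ≤ ‖x 0 - p‖ ^ 2 / 2 := by
  have h1 := sum_gap_le hG hT hx p k
  have h2 : ∑ j ∈ Finset.range k, (G (x k) - G p) ≤
      ∑ j ∈ Finset.range k, (G (x (j + 1)) - G p) := by
    refine Finset.sum_le_sum fun j hj => ?_
    have := antitone_values hT hx (Finset.mem_range.1 hj : j + 1 ≤ k)
    simp only at this
    linarith
  rw [Finset.sum_const, Finset.card_range, nsmul_eq_mul] at h2
  nlinarith [sq_nonneg ‖x k - p‖]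

theorem residual_le (hG : ConvexOn ℝ Set.univ G)
    (hT : ∀ x y, G y ≤ G x + inner ℝ (x - T x) (y - x) + ‖y - x‖ ^ 2 / 2) {x : ℕ → Space d}
    (hx : ∀ k, x (k + 1) = T (x k)) {p : Space d} (hp : p ∈ argminSet G) {k : ℕ} (hk : 1 ≤ k) :
    ‖x k - T (x k)‖ ≤ 2 * ‖x 0 - p‖ / (k + 1) := by
  have hF := firmlyNonexpansive_of_convexOn hG hT
  set g := ‖x k - T (x k)‖ with hg
  -- Residuals decrease, so every step up to the one leaving `x k` lowers `G` by at least `g² / 2`.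
  -- Counting back from `k`, the gap at `x (k - m)` contains `m + 1` such drops.
  have hj : ∀ m, m ≤ k → (m + 1) * (g ^ 2 / 2) ≤ G (x (k - m)) - G p := by
    intro m
    induction m with
    | zero =>
      intro _
      have h1 := descent hT (x k)
      have h2 := hp (T (x k))
      simp only [Nat.sub_zero, Nat.cast_zero]
      linarith
    | succ m ih =>
      intro hm
      have h0 := ih (by omega)
      have h1 := descent hT (x (k - (m + 1)))
      rw [← hx, show k - (m + 1) + 1 = k - m by omega] at h1
      have h2 : g ≤ ‖x (k - (m + 1)) - T (x (k - (m + 1)))‖ :=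
        norm_residual_antitone hF hx (Nat.sub_le k (m + 1))
      rw [← hx, show k - (m + 1) + 1 = k - m by omega] at h2
      have h3 : g ^ 2 ≤ ‖x (k - (m + 1)) - x (k - m)‖ ^ 2 :=
        pow_le_pow_left₀ (norm_nonneg _) h2 2
      push_cast
      linarith
  have hs := sum_gap_le hG hT hx p k
  rw [← Finset.sum_range_reflect] at hs
  have h1 : ∑ m ∈ Finset.range k, ((m : ℝ) + 1) * (g ^ 2 / 2) ≤
      ∑ m ∈ Finset.range k, (G (x (k - 1 - m + 1)) - G p) := by
    refine Finset.sum_le_sum fun m hm => ?_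
    have hm' := Finset.mem_range.1 hm
    rw [show k - 1 - m + 1 = k - m by omega]
    exact hj m hm'.le
  have h2 : ∀ n : ℕ, ∑ m ∈ Finset.range n, ((m : ℝ) + 1) * (g ^ 2 / 2) =
      n * (n + 1) / 2 * (g ^ 2 / 2) := by
    intro n
    induction n with
    | zero => simp
    | succ n ih => rw [Finset.sum_range_succ, ih]; push_cast; ring
  rw [h2] at h1
  have hk' : (1 : ℝ) ≤ k := by exact_mod_cast hk
  rw [le_div_iff₀ (by positivity)]
  refine le_of_sq_le_sq ?_ (by positivity)
  have h3 : (k : ℝ) * (k + 1) * g ^ 2 ≤ 2 * ‖x 0 - p‖ ^ 2 := by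
    nlinarith [sq_nonneg ‖x k - p‖]
  -- Here `k + 1 ≤ 2 k` is used; it needs `k ≥ 1` and turns `k (k + 1)` into `(k + 1)²`.
  have h4 : (g * (k + 1)) ^ 2 ≤ 2 * ((k : ℝ) * (k + 1) * g ^ 2) := by
    have : 0 ≤ g ^ 2 * (((k : ℝ) + 1) * (k - 1)) :=
      mul_nonneg (sq_nonneg _) (mul_nonneg (by linarith) (by linarith))
    nlinarith
  nlinarith

/-- Distances to every minimizer decrease, so the orbit is bounded and has a cluster point. The
values tend to the minimum, so that point is itself a minimizer, and monotonicity of the distance to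
it upgrades the subsequence to the whole sequence. -/
theorem exists_tendsto (hG : ConvexOn ℝ Set.univ G)
    (hT : ∀ x y, G y ≤ G x + inner ℝ (x - T x) (y - x) + ‖y - x‖ ^ 2 / 2) {x : ℕ → Space d}
    (hx : ∀ k, x (k + 1) = T (x k)) {p : Space d} (hp : p ∈ argminSet G) :
    ∃ q ∈ argminSet G, Filter.Tendsto x Filter.atTop (nhds q) := by
  have hF := firmlyNonexpansive_of_convexOn hG hT
  have hcont : Continuous G := continuous_iff_continuousAt.2 fun y =>
    (hasGradientAt_of_convexOn hG hT y).continuousAt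
  have hfejer : ∀ q ∈ argminSet G, Antitone fun k => dist (x k) q := by
    intro q hq
    refine antitone_nat_of_succ_le fun k => ?_
    have := hF.norm_sub_le (x k) q
    rwa [eq_of_mem_argminSet hT hq, ← hx k, ← dist_eq_norm, ← dist_eq_norm] at this
  obtain ⟨q, -, φ, hφ, hlim⟩ := (isCompact_closedBall p (dist (x 0) p)).tendsto_subseq
    (x := x) (fun k => Metric.mem_closedBall.2 (hfejer p hp (Nat.zero_le k)))
  have hval : Filter.Tendsto (fun k => G (x k)) Filter.atTop (nhds (G p)) := by
    have h1 : Filter.Tendsto (fun k : ℕ => G p + (‖x 0 - p‖ ^ 2 / 2) / k) Filter.atTop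
        (nhds (G p + 0)) := tendsto_const_nhds.add (tendsto_const_div_atTop_nhds_zero_nat _)
    rw [add_zero] at h1
    refine tendsto_of_tendsto_of_tendsto_of_le_of_le' tendsto_const_nhds h1
      (.of_forall fun k => hp _) ?_
    filter_upwards [Filter.eventually_gt_atTop 0] with k hk
    have hk' : (0 : ℝ) < k := by exact_mod_cast hk
    have := gap_le hG hT hx p k
    have h2 : G (x k) - G p ≤ (‖x 0 - p‖ ^ 2 / 2) / k := by
      rw [le_div_iff₀ hk', mul_comm]; exact this
    linarith
  have hq : G q = G p := tendsto_nhds_unique ((hcont.tendsto q).comp hlim)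
    (hval.comp hφ.tendsto_atTop)
  have hqm : q ∈ argminSet G := fun y => hq ▸ hp y
  refine ⟨q, hqm, ?_⟩
  rw [tendsto_iff_dist_tendsto_zero] at hlim ⊢
  rw [Metric.tendsto_atTop] at hlim ⊢
  intro ε hε
  obtain ⟨N, hN⟩ := hlim ε hε
  refine ⟨φ N, fun n hn => ?_⟩
  have h1 := hN N le_rfl
  rw [Real.dist_0_eq_abs, abs_of_nonneg dist_nonneg] at h1 ⊢
  exact (hfejer q hqm hn).trans_lt h1

end Iteration

/-! ### The Prékopa–Leindler inequality -/

section PrekopaLeindler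

open MeasureTheory ENNReal Pointwise

/-- One-dimensional Brunn–Minkowski: `K + inf L` and `sup K + L` both lie in `C` and meet at most in
the single point `sup K + inf L`. -/
theorem volume_add_volume_le_of_isCompact {K L C : Set ℝ} (hK : IsCompact K) (hL : IsCompact L)
    (hK0 : K.Nonempty) (hL0 : L.Nonempty) (h : ∀ a ∈ K, ∀ b ∈ L, a + b ∈ C) :
    volume K + volume L ≤ volume C := by
  have hk := hK.sSup_mem hK0
  have hl := hL.sInf_mem hL0
  set k := sSup K
  set l := sInf L
  have e1 : volume ((fun x => x + l) '' K) = volume K := by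
    rw [Set.image_add_right, measure_preimage_add_right]
  have e2 : volume ((fun x => k + x) '' L) = volume L := by
    rw [Set.image_add_left, measure_preimage_add]
  have hm : MeasurableSet ((fun x => k + x) '' L) :=
    (hL.image (continuous_const.add continuous_id)).measurableSet
  rw [← e1, ← e2, ← measure_union₀ hm.nullMeasurableSet]
  · refine measure_mono ?_
    rintro _ (⟨a, ha, rfl⟩ | ⟨b, hb, rfl⟩)
    · exact h a ha l hl
    · exact h k hk b hb
  · refine measure_mono_null (t := {k + l}) ?_ (by simp)
    rintro _ ⟨⟨a, ha, rfl⟩, ⟨b, hb, hab⟩⟩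
    have h1 : a ≤ k := le_csSup hK.bddAbove ha
    have h2 : l ≤ b := csInf_le hL.bddBelow hb
    simp only at hab
    simp only [Set.mem_singleton_iff]
    linarith

theorem volume_add_volume_le {A B C : Set ℝ} (hA : MeasurableSet A) (hB : MeasurableSet B)
    (hA0 : A.Nonempty) (hB0 : B.Nonempty) (h : ∀ a ∈ A, ∀ b ∈ B, a + b ∈ C) :
    volume A + volume B ≤ volume C := by
  obtain ⟨a, ha⟩ := hA0
  obtain ⟨b, hb⟩ := hB0
  rw [hA.measure_eq_iSup_isCompact, hB.measure_eq_iSup_isCompact]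
  simp only [iSup_and']
  refine ENNReal.biSup_add_biSup_le' ⟨∅, Set.empty_subset _, isCompact_empty⟩
    ⟨∅, Set.empty_subset _, isCompact_empty⟩ fun K ⟨hKA, hK⟩ L ⟨hLB, hL⟩ => ?_
  -- Inner regularity may supply empty compact sets; inserting `a` and `b` makes them nonempty.
  refine le_trans (add_le_add (measure_mono (Set.subset_insert a K))
    (measure_mono (Set.subset_insert b L))) ?_
  refine volume_add_volume_le_of_isCompact (hK.insert a) (hL.insert b) (Set.insert_nonempty _ _)
    (Set.insert_nonempty _ _) fun x hx y hy => h x ?_ y ?_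
  · exact Set.insert_subset ha hKA hx
  · exact Set.insert_subset hb hLB hy

theorem volume_convexComb_le {t : ℝ} (ht0 : 0 < t) (ht1 : t < 1) {A B C : Set ℝ}
    (hA : MeasurableSet A) (hB : MeasurableSet B) (hA0 : A.Nonempty) (hB0 : B.Nonempty)
    (h : ∀ a ∈ A, ∀ b ∈ B, (1 - t) * a + t * b ∈ C) :
    ENNReal.ofReal (1 - t) * volume A + ENNReal.ofReal t * volume B ≤ volume C := by
  have h1 : (0 : ℝ) < 1 - t := by linarith
  have e : ∀ r : ℝ, 0 < r → ∀ S : Set ℝ, volume (r • S) = ENNReal.ofReal r * volume S := by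
    intro r hr S
    rw [Measure.addHaar_smul]
    simp [abs_of_pos hr]
  rw [← e _ h1, ← e _ ht0]
  refine volume_add_volume_le (hA.const_smul₀ _) (hB.const_smul₀ _) hA0.smul_set hB0.smul_set ?_
  rintro _ ⟨a, ha, rfl⟩ _ ⟨b, hb, rfl⟩
  exact h a ha b hb

theorem rpow_mul_rpow_le {t : ℝ} (ht0 : 0 < t) (ht1 : t < 1) (a b : ℝ≥0∞) :
    a ^ (1 - t) * b ^ t ≤ ENNReal.ofReal (1 - t) * a + ENNReal.ofReal t * b := by
  have h1 : (0 : ℝ) < 1 - t := by linarith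
  have hpq : (1 - t)⁻¹.HolderConjugate t⁻¹ := by
    rw [Real.holderConjugate_iff]
    refine ⟨(one_lt_inv₀ h1).2 (by linarith), by simp⟩
  have := ENNReal.young_inequality (a ^ (1 - t)) (b ^ t) hpq
  rw [← ENNReal.rpow_mul, ← ENNReal.rpow_mul, mul_inv_cancel₀ h1.ne', mul_inv_cancel₀ ht0.ne',
    ENNReal.rpow_one, ENNReal.rpow_one, ENNReal.ofReal_inv_of_pos h1,
    ENNReal.ofReal_inv_of_pos ht0, ENNReal.div_eq_inv_mul, ENNReal.div_eq_inv_mul, inv_inv,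
    inv_inv] at this
  exact this

theorem lintegral_eq_lintegral_volume_lt {f : ℝ → ℝ≥0∞} (hf : Measurable f) (hf1 : ∀ x, f x ≤ 1) :
    ∫⁻ x, f x = ∫⁻ u in Set.Ioi (0 : ℝ), volume {x | ENNReal.ofReal u < f x} := by
  have h1 : ∀ x, f x ≠ ∞ := fun x => ((hf1 x).trans_lt one_lt_top).ne
  have h2 := lintegral_eq_lintegral_meas_lt volume (f := fun x => (f x).toReal)
    (.of_forall fun _ => ENNReal.toReal_nonneg) hf.ennreal_toReal.aemeasurable
  simp only [ENNReal.ofReal_toReal (h1 _)] at h2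
  rw [h2]
  refine setLIntegral_congr_fun measurableSet_Ioi fun u hu => ?_
  refine congrArg volume (Set.ext fun x => ?_)
  exact (ENNReal.ofReal_lt_iff_lt_toReal (le_of_lt hu) (h1 x)).symm

/-- With both suprema equal to 1, the superlevel sets of `f` and `g` are nonempty at every level
below 1 and empty from 1 on. Brunn–Minkowski on each level and the layer-cake formula yield the
bound with an arithmetic mean, stronger than the geometric one. -/
theorem prekopaLeindler_normalized {t : ℝ} (ht0 : 0 < t) (ht1 : t < 1) {f g h : ℝ → ℝ≥0∞}
    (hf : Measurable f) (hg : Measurable g) (hh : Measurable h)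
    (hf1 : ⨆ x, f x = 1) (hg1 : ⨆ x, g x = 1)
    (H : ∀ x y, f x ^ (1 - t) * g y ^ t ≤ h ((1 - t) * x + t * y)) :
    (∫⁻ x, f x) ^ (1 - t) * (∫⁻ x, g x) ^ t ≤ ∫⁻ x, h x := by
  have h1 : (0 : ℝ) < 1 - t := by linarith
  have hf1' : ∀ x, f x ≤ 1 := fun x => hf1 ▸ le_iSup f x
  have hg1' : ∀ x, g x ≤ 1 := fun x => hg1 ▸ le_iSup g x
  refine (rpow_mul_rpow_le ht0 ht1 _ _).trans ?_
  refine le_trans ?_ (lintegral_mono fun x => min_le_left (h x) 1)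
  rw [lintegral_eq_lintegral_volume_lt hf hf1', lintegral_eq_lintegral_volume_lt hg hg1',
    lintegral_eq_lintegral_volume_lt (hh.min measurable_const) fun x => min_le_right _ _,
    ← lintegral_const_mul' _ _ ofReal_ne_top, ← lintegral_const_mul' _ _ ofReal_ne_top,
    ← lintegral_add_left']
  swap
  · refine (Antitone.measurable ?_).aemeasurable
    intro u v huv
    refine mul_le_mul_right (measure_mono fun x hx => ?_) _
    exact (ENNReal.ofReal_le_ofReal huv).trans_lt hx
  refine setLIntegral_mono' measurableSet_Ioi fun u hu => ?_
  rcases lt_or_ge u 1 with hu1 | hu1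
  · have hu1' : ENNReal.ofReal u < 1 := by rwa [ENNReal.ofReal_lt_one]
    have hne : ∀ {f : ℝ → ℝ≥0∞}, ⨆ x, f x = 1 → {x | ENNReal.ofReal u < f x}.Nonempty := by
      intro f hf
      obtain ⟨x, hx⟩ := lt_iSup_iff.1 (hu1'.trans_eq hf.symm)
      exact ⟨x, hx⟩
    refine volume_convexComb_le ht0 ht1 (measurableSet_lt measurable_const hf)
      (measurableSet_lt measurable_const hg) (hne hf1) (hne hg1)
      fun a ha b hb => ?_
    refine lt_min (lt_of_lt_of_le ?_ (H a b)) hu1'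
    have hu0 : ENNReal.ofReal u ≠ 0 := by
      rw [Ne, ENNReal.ofReal_eq_zero, not_le]; exact hu
    calc ENNReal.ofReal u = ENNReal.ofReal u ^ (1 - t) * ENNReal.ofReal u ^ t := by
          rw [← ENNReal.rpow_add _ _ hu0 ofReal_ne_top, sub_add_cancel, ENNReal.rpow_one]
      _ < f a ^ (1 - t) * g b ^ t :=
          ENNReal.mul_lt_mul (ENNReal.rpow_lt_rpow ha h1) (ENNReal.rpow_lt_rpow hb ht0)
  · have e : ∀ {f : ℝ → ℝ≥0∞}, (∀ x, f x ≤ 1) → {x | ENNReal.ofReal u < f x} = ∅ := by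
      intro f hf
      refine Set.eq_empty_iff_forall_notMem.2 fun x hx => ?_
      exact absurd (lt_of_lt_of_le hx (hf x)) (not_lt.2 (ENNReal.one_le_ofReal.2 hu1))
    rw [e hf1', e hg1']
    simp

theorem prekopaLeindler_bounded {t : ℝ} (ht0 : 0 < t) (ht1 : t < 1) {f g h : ℝ → ℝ≥0∞}
    (hf : Measurable f) (hg : Measurable g) (hh : Measurable h)
    (hf1 : ⨆ x, f x ≠ ∞) (hg1 : ⨆ x, g x ≠ ∞)
    (H : ∀ x y, f x ^ (1 - t) * g y ^ t ≤ h ((1 - t) * x + t * y)) :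
    (∫⁻ x, f x) ^ (1 - t) * (∫⁻ x, g x) ^ t ≤ ∫⁻ x, h x := by
  have h1 : (0 : ℝ) < 1 - t := by linarith
  set a := ⨆ x, f x with ha
  set b := ⨆ x, g x with hb
  rcases eq_or_ne a 0 with ha0 | ha0
  · have : ∀ x, f x = 0 := fun x => nonpos_iff_eq_zero.1 (ha0 ▸ le_iSup f x)
    simp [this, h1]
  rcases eq_or_ne b 0 with hb0 | hb0
  · have : ∀ x, g x = 0 := fun x => nonpos_iff_eq_zero.1 (hb0 ▸ le_iSup g x)
    simp [this, ht0]
  set c := a ^ (1 - t) * b ^ t with hc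
  have hai : a⁻¹ ≠ ∞ := ENNReal.inv_ne_top.2 ha0
  have hbi : b⁻¹ ≠ ∞ := ENNReal.inv_ne_top.2 hb0
  have hc0 : c ≠ 0 := mul_ne_zero (ENNReal.rpow_pos (pos_iff_ne_zero.2 ha0) hf1).ne'
    (ENNReal.rpow_pos (pos_iff_ne_zero.2 hb0) hg1).ne'
  have hct : c ≠ ∞ := ENNReal.mul_ne_top (ENNReal.rpow_ne_top_of_nonneg h1.le hf1)
    (ENNReal.rpow_ne_top_of_nonneg ht0.le hg1)
  have hsplit : ∀ u v : ℝ≥0∞, (a⁻¹ * u) ^ (1 - t) * (b⁻¹ * v) ^ t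
      = c⁻¹ * (u ^ (1 - t) * v ^ t) := by
    intro u v
    rw [ENNReal.mul_rpow_of_nonneg _ _ h1.le, ENNReal.mul_rpow_of_nonneg _ _ ht0.le, hc,
      ENNReal.mul_inv (Or.inr (ENNReal.rpow_ne_top_of_nonneg ht0.le hg1))
        (Or.inl (ENNReal.rpow_ne_top_of_nonneg h1.le hf1)), ENNReal.inv_rpow, ENNReal.inv_rpow]
    ring
  have key := prekopaLeindler_normalized ht0 ht1 (f := fun x => a⁻¹ * f x)
    (g := fun x => b⁻¹ * g x) (h := fun x => c⁻¹ * h x) (hf.const_mul _) (hg.const_mul _)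
    (hh.const_mul _) (by rw [← ENNReal.mul_iSup, ← ha, ENNReal.inv_mul_cancel ha0 hf1])
    (by rw [← ENNReal.mul_iSup, ← hb, ENNReal.inv_mul_cancel hb0 hg1])
    (fun x y => by rw [hsplit]; exact mul_le_mul_right (H x y) _)
  rw [lintegral_const_mul' _ _ hai, lintegral_const_mul' _ _ hbi,
    lintegral_const_mul' _ _ (ENNReal.inv_ne_top.2 hc0), hsplit] at key
  exact (ENNReal.mul_le_mul_iff_right (ENNReal.inv_ne_zero.2 hct) (ENNReal.inv_ne_top.2 hc0)).1 key

theorem tendsto_lintegral_min_natCast {f : ℝ → ℝ≥0∞} (hf : Measurable f) :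
    Filter.Tendsto (fun n : ℕ => ∫⁻ x, min (f x) n) Filter.atTop (nhds (∫⁻ x, f x)) := by
  refine lintegral_tendsto_of_tendsto_of_monotone
    (fun n => (hf.min measurable_const).aemeasurable) (.of_forall fun x m n hmn => ?_)
    (.of_forall fun x => ?_)
  · exact min_le_min le_rfl (by exact_mod_cast hmn)
  · have : Filter.Tendsto (fun n : ℕ => min (f x) (n : ℝ≥0∞)) Filter.atTop (nhds (min (f x) ∞)) :=
      tendsto_const_nhds.min ENNReal.tendsto_nat_nhds_top
    rwa [min_eq_left le_top] at this

/-- The Prékopa–Leindler inequality on the real line. -/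
theorem prekopaLeindler_real {t : ℝ} (ht0 : 0 < t) (ht1 : t < 1) {f g h : ℝ → ℝ≥0∞}
    (hf : Measurable f) (hg : Measurable g) (hh : Measurable h)
    (H : ∀ x y, f x ^ (1 - t) * g y ^ t ≤ h ((1 - t) * x + t * y)) :
    (∫⁻ x, f x) ^ (1 - t) * (∫⁻ x, g x) ^ t ≤ ∫⁻ x, h x := by
  have h1 : (0 : ℝ) < 1 - t := by linarith
  rcases eq_or_ne (∫⁻ x, f x) 0 with hf0 | hf0
  · simp [hf0, h1]
  rcases eq_or_ne (∫⁻ x, g x) 0 with hg0 | hg0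
  · simp [hg0, ht0]
  have hb : ∀ (f : ℝ → ℝ≥0∞) (n : ℕ), ⨆ x, min (f x) n ≠ ∞ := fun f n =>
    ((iSup_le fun x => min_le_right _ _).trans_lt (ENNReal.natCast_lt_top n)).ne
  have key : ∀ n : ℕ, (∫⁻ x, min (f x) n) ^ (1 - t) * (∫⁻ x, min (g x) n) ^ t ≤ ∫⁻ x, h x :=
    fun n => prekopaLeindler_bounded ht0 ht1 (hf.min measurable_const) (hg.min measurable_const) hh
      (hb f n) (hb g n) fun x y => le_trans (mul_le_mul'
        (ENNReal.rpow_le_rpow (min_le_left _ _) h1.le)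
        (ENNReal.rpow_le_rpow (min_le_left _ _) ht0.le)) (H x y)
  have l1 := (ENNReal.continuous_rpow_const (y := 1 - t)).tendsto _ |>.comp
    (tendsto_lintegral_min_natCast hf)
  have l2 := (ENNReal.continuous_rpow_const (y := t)).tendsto _ |>.comp
    (tendsto_lintegral_min_natCast hg)
  -- Multiplication on `ℝ≥0∞` is discontinuous at `0 * ∞`, which is why the zero integrals were
  -- split off.
  refine le_of_tendsto (ENNReal.Tendsto.mul l1 (Or.inl ?_) l2 (Or.inl ?_)) (.of_forall key)
  · rw [Ne, ENNReal.rpow_eq_zero_iff_of_pos h1]; exact hf0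
  · rw [Ne, ENNReal.rpow_eq_zero_iff_of_pos ht0]; exact hg0

theorem measurable_fin_cons {n : ℕ} :
    Measurable fun p : ℝ × (Fin n → ℝ) => (Fin.cons p.1 p.2 : Fin (n + 1) → ℝ) := by
  have e : ∀ p : ℝ × (Fin n → ℝ), (Fin.cons p.1 p.2 : Fin (n + 1) → ℝ) =
      (MeasurableEquiv.piFinSuccAbove (fun _ : Fin (n + 1) => ℝ) 0).symm p :=
    fun p => (Fin.insertNth_zero' _ _).symm
  simp only [e]
  exact MeasurableEquiv.measurable _

theorem lintegral_fin_succ {n : ℕ} {f : (Fin (n + 1) → ℝ) → ℝ≥0∞} (hf : Measurable f) :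
    ∫⁻ x, f x = ∫⁻ a : ℝ, ∫⁻ v : Fin n → ℝ, f (Fin.cons a v) := by
  have e := (volume_preserving_piFinSuccAbove (fun _ : Fin (n + 1) => ℝ) 0).symm
  have h := e.lintegral_comp hf
  rw [← h, Measure.volume_eq_prod, lintegral_prod (fun p => f
    ((MeasurableEquiv.piFinSuccAbove (fun _ : Fin (n + 1) => ℝ) 0).symm p))
    (hf.comp e.measurable).aemeasurable]
  refine lintegral_congr fun a => lintegral_congr fun v => congrArg f ?_
  exact Fin.insertNth_zero' _ _

/-- The Prékopa–Leindler inequality on `ℝⁿ`. -/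
theorem prekopaLeindler_pi {t : ℝ} (ht0 : 0 < t) (ht1 : t < 1) {n : ℕ} :
    ∀ {f g h : (Fin n → ℝ) → ℝ≥0∞}, Measurable f → Measurable g → Measurable h →
    (∀ x y, f x ^ (1 - t) * g y ^ t ≤ h ((1 - t) • x + t • y)) →
    (∫⁻ x, f x) ^ (1 - t) * (∫⁻ x, g x) ^ t ≤ ∫⁻ x, h x := by
  induction n with
  | zero =>
    intro f g h _ _ _ H
    have e : ∀ f : (Fin 0 → ℝ) → ℝ≥0∞, ∫⁻ x, f x = f 0 := by
      intro f
      rw [lintegral_unique, Measure.volume_pi_eq_dirac 0]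
      rw [Measure.dirac_apply_of_mem (Set.mem_univ _), mul_one]
      exact congrArg f (Subsingleton.elim _ _)
    rw [e, e, e]
    simpa using H 0 0
  | succ n ih =>
    intro f g h hf hg hh H
    rw [lintegral_fin_succ hf, lintegral_fin_succ hg, lintegral_fin_succ hh]
    -- The line inequality is applied to the marginals in the first coordinate; its hypothesis is
    -- the induction hypothesis on slices.
    refine prekopaLeindler_real ht0 ht1 (hf.comp measurable_fin_cons).lintegral_prod_right'
      (hg.comp measurable_fin_cons).lintegral_prod_right'
      (hh.comp measurable_fin_cons).lintegral_prod_right' fun a b => ?_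
    refine ih (hf.comp (measurable_fin_cons.comp measurable_prodMk_left))
      (hg.comp (measurable_fin_cons.comp measurable_prodMk_left))
      (hh.comp (measurable_fin_cons.comp measurable_prodMk_left)) fun v w => ?_
    have e : (Fin.cons ((1 - t) * a + t * b) ((1 - t) • v + t • w) : Fin (n + 1) → ℝ)
        = (1 - t) • Fin.cons a v + t • Fin.cons b w := by
      ext i
      refine Fin.cases ?_ (fun i => ?_) i <;> simp
    simp only [e]
    exact H _ _

theorem prekopaLeindler {t : ℝ} (ht0 : 0 < t) (ht1 : t < 1) {d : ℕ} {f g h : Space d → ℝ≥0∞}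
    (hf : Measurable f) (hg : Measurable g) (hh : Measurable h)
    (H : ∀ x y, f x ^ (1 - t) * g y ^ t ≤ h ((1 - t) • x + t • y)) :
    (∫⁻ x, f x) ^ (1 - t) * (∫⁻ x, g x) ^ t ≤ ∫⁻ x, h x := by
  have e := PiLp.volume_preserving_toLp (Fin d)
  rw [← e.lintegral_comp hf, ← e.lintegral_comp hg, ← e.lintegral_comp hh]
  refine prekopaLeindler_pi ht0 ht1 (hf.comp e.measurable) (hg.comp e.measurable)
    (hh.comp e.measurable) fun x y => ?_
  simpa using H (WithLp.toLp 2 x) (WithLp.toLp 2 y)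

end PrekopaLeindler

/-! ### Gaussian smoothing: upper model, coercivity, log-concavity -/

section Heat

open MeasureTheory

variable {d : ℕ}

/-- The unnormalized Gaussian smoothing of the weight `w` at variance `s`. -/
noncomputable def heat (s : ℝ) (w : Space d → ℝ) (x : Space d) : ℝ :=
  ∫ y, Real.exp (-‖y - x‖ ^ 2 / (2 * s)) * w y

/-- The barycenter of the weight `w` localized around `x` by a Gaussian of variance `s`. -/
noncomputable def heatMean (s : ℝ) (w : Space d → ℝ) (x : Space d) : Space d :=
  (heat s w x)⁻¹ • ∫ y, (Real.exp (-‖y - x‖ ^ 2 / (2 * s)) * w y) • y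

/-- The smoothed potential `-s log (heat s w)`. -/
noncomputable def heatPotential (s : ℝ) (w : Space d → ℝ) (x : Space d) : ℝ :=
  -s * Real.log (heat s w x)

variable {s : ℝ} {w : Space d → ℝ}

theorem exp_neg_sq_le_one (hs : 0 < s) (x y : Space d) :
    Real.exp (-‖y - x‖ ^ 2 / (2 * s)) ≤ 1 := by
  rw [Real.exp_le_one_iff]
  exact div_nonpos_of_nonpos_of_nonneg (neg_nonpos.2 (sq_nonneg _)) (by positivity)

theorem mul_exp_neg_sq_le (hs : 0 < s) (r : ℝ) :
    r * Real.exp (-r ^ 2 / (2 * s)) ≤ 1 + s := by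
  have h1 := Real.add_one_le_exp (r ^ 2 / (2 * s))
  have h2 : r ≤ (1 + s) * (r ^ 2 / (2 * s) + 1) := by
    have h3 : s * (r ^ 2 / (2 * s)) = r ^ 2 / 2 := by field_simp
    have h4 : 0 ≤ r ^ 2 / (2 * s) := by positivity
    nlinarith [sq_nonneg (r - 1)]
  rw [neg_div, Real.exp_neg, ← div_eq_mul_inv, div_le_iff₀ (Real.exp_pos _)]
  exact h2.trans (mul_le_mul_of_nonneg_left h1 (by linarith))

theorem integrable_heat (hs : 0 < s) (hi : Integrable w) (x : Space d) :
    Integrable fun y => Real.exp (-‖y - x‖ ^ 2 / (2 * s)) * w y := by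
  refine hi.bdd_mul (c := 1) (by fun_prop) (.of_forall fun y => ?_)
  rw [Real.norm_of_nonneg (Real.exp_pos _).le]
  exact exp_neg_sq_le_one hs x y

/-- `w` need not have a first moment; the Gaussian factor keeps its product with `y` bounded. -/
theorem integrable_heat_smul (hs : 0 < s) (hi : Integrable w) (x : Space d) :
    Integrable fun y => (Real.exp (-‖y - x‖ ^ 2 / (2 * s)) * w y) • y := by
  have h : Integrable fun y => w y • (Real.exp (-‖y - x‖ ^ 2 / (2 * s)) • y) := by
    refine hi.smul_bdd (1 + s + ‖x‖) (by fun_prop) (.of_forall fun y => ?_)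
    rw [norm_smul, Real.norm_of_nonneg (Real.exp_pos _).le]
    have h1 := mul_exp_neg_sq_le hs ‖y - x‖
    have h2 : ‖y‖ ≤ ‖y - x‖ + ‖x‖ := by simpa using norm_add_le (y - x) x
    have h3 := exp_neg_sq_le_one hs x y
    nlinarith [Real.exp_pos (-‖y - x‖ ^ 2 / (2 * s)), norm_nonneg x]
  refine h.congr (.of_forall fun y => ?_)
  simp only [smul_smul, mul_comm]

theorem heat_pos (hs : 0 < s) (hi : Integrable w) (hw : ∀ y, 0 < w y) (x : Space d) :
    0 < heat s w x := by
  have hp : ∀ y, 0 < Real.exp (-‖y - x‖ ^ 2 / (2 * s)) * w y :=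
    fun y => mul_pos (Real.exp_pos _) (hw y)
  refine (integral_pos_iff_support_of_nonneg (fun y => (hp y).le) (integrable_heat hs hi x)).2 ?_
  rw [Function.support_eq_univ fun y => (hp y).ne']
  exact NeZero.pos _

theorem integral_heat_inner (hs : 0 < s) (hi : Integrable w) (hw : ∀ y, 0 < w y)
    (x v : Space d) :
    ∫ y, (Real.exp (-‖y - x‖ ^ 2 / (2 * s)) * w y) * inner ℝ v y =
      heat s w x * inner ℝ v (heatMean s w x) := by
  rw [heatMean, inner_smul_right, ← mul_assoc, mul_inv_cancel₀ (heat_pos hs hi hw x).ne', one_mul,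
    ← integral_inner (integrable_heat_smul hs hi x)]
  simp only [inner_smul_right]

/-- Passing from `x` to `x'` multiplies the kernel by a constant times `exp (⟨x' - x, y - m⟩ / s)`.
By `exp r ≥ 1 + r`, the linear term integrates to zero because `m` is the barycenter: Jensen's
inequality in tangent form. -/
theorem heat_mul_exp_le (hs : 0 < s) (hi : Integrable w) (hw : ∀ y, 0 < w y) (x x' : Space d) :
    heat s w x * Real.exp (inner ℝ (x' - x) (heatMean s w x) / s + (‖x‖ ^ 2 - ‖x'‖ ^ 2) / (2 * s))
      ≤ heat s w x' := by
  set m := heatMean s w x with hm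
  set a := inner ℝ (x' - x) m / s + (‖x‖ ^ 2 - ‖x'‖ ^ 2) / (2 * s) with ha
  set k : Space d → ℝ := fun y => Real.exp (-‖y - x‖ ^ 2 / (2 * s)) * w y with hk
  have hki : Integrable k := integrable_heat hs hi x
  have hki2 : Integrable fun y => k y * inner ℝ (x' - x) y := by
    have := (integrable_heat_smul hs hi x).const_inner (𝕜 := ℝ) (x' - x)
    simpa only [inner_smul_right] using this
  have e1 : ∫ y, (Real.exp a * (1 - inner ℝ (x' - x) m / s) * k y
      + Real.exp a / s * (k y * inner ℝ (x' - x) y)) = heat s w x * Real.exp a := by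
    rw [integral_add (hki.const_mul _) (hki2.const_mul _), integral_const_mul,
      integral_const_mul, integral_heat_inner hs hi hw, ← hm]
    change _ * heat s w x + _ = _
    ring
  rw [← e1]
  refine integral_mono ((hki.const_mul _).add (hki2.const_mul _)) (integrable_heat hs hi x')
    fun y => ?_
  have h1 := Real.add_one_le_exp (inner ℝ (x' - x) (y - m) / s)
  have h2 : Real.exp (-‖y - x'‖ ^ 2 / (2 * s)) = Real.exp (-‖y - x‖ ^ 2 / (2 * s)) *
      (Real.exp a * Real.exp (inner ℝ (x' - x) (y - m) / s)) := by
    rw [← Real.exp_add, ← Real.exp_add]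
    congr 1
    rw [ha, norm_sub_sq_real, norm_sub_sq_real, inner_sub_right, inner_sub_left _ _ y,
      real_inner_comm y x, real_inner_comm y x']
    field_simp
    ring
  simp only [h2]
  have h3 : 0 < k y * Real.exp a := mul_pos (mul_pos (Real.exp_pos _) (hw y)) (Real.exp_pos a)
  have h4 := mul_le_mul_of_nonneg_left h1 h3.le
  rw [inner_sub_right, sub_div] at h4
  calc _ = k y * Real.exp a * (inner ℝ (x' - x) y / s - inner ℝ (x' - x) m / s + 1) := by ring
    _ ≤ _ := h4
    _ = _ := by rw [hk, ← sub_div, ← inner_sub_right]; ring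

theorem heatPotential_le (hs : 0 < s) (hi : Integrable w) (hw : ∀ y, 0 < w y) (x y : Space d) :
    heatPotential s w y ≤
      heatPotential s w x + inner ℝ (x - heatMean s w x) (y - x) + ‖y - x‖ ^ 2 / 2 := by
  have h := Real.log_le_log (mul_pos (heat_pos hs hi hw x) (Real.exp_pos _))
    (heat_mul_exp_le hs hi hw x y)
  rw [Real.log_mul (heat_pos hs hi hw x).ne' (Real.exp_pos _).ne', Real.log_exp] at h
  have h1 := mul_le_mul_of_nonneg_left h hs.le
  have h2 : s * (inner ℝ (y - x) (heatMean s w x) / s + (‖x‖ ^ 2 - ‖y‖ ^ 2) / (2 * s))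
      = inner ℝ (y - x) (heatMean s w x) + (‖x‖ ^ 2 - ‖y‖ ^ 2) / 2 := by field_simp
  rw [mul_add, h2] at h1
  have h3 : ‖y‖ ^ 2 = ‖x‖ ^ 2 + 2 * inner ℝ x (y - x) + ‖y - x‖ ^ 2 := by
    rw [← norm_add_sq_real, add_sub_cancel]
  unfold heatPotential
  rw [inner_sub_left, real_inner_comm (y - x) (heatMean s w x)]
  linarith

theorem tendsto_heat_cocompact (hs : 0 < s) (hi : Integrable w) :
    Filter.Tendsto (heat s w) (Filter.cocompact (Space d)) (nhds 0) := by
  have hc : Filter.cocompact (Space d) = Filter.comap norm Filter.atTop := by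
    rw [comap_norm_atTop, Metric.cobounded_eq_cocompact]
  have : (Filter.cocompact (Space d)).IsCountablyGenerated := by rw [hc]; infer_instance
  have h0 : (0 : ℝ) = ∫ _ : Space d, (0 : ℝ) := by simp
  rw [h0]
  refine tendsto_integral_filter_of_dominated_convergence (fun y => ‖w y‖)
    (.of_forall fun x => (integrable_heat hs hi x).1) (.of_forall fun x => .of_forall fun y => ?_)
    hi.norm (.of_forall fun y => ?_)
  · rw [norm_mul, Real.norm_of_nonneg (Real.exp_pos _).le]
    exact mul_le_of_le_one_left (norm_nonneg _) (exp_neg_sq_le_one hs x y)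
  · rw [← zero_mul (w y)]
    refine Filter.Tendsto.mul_const _ (Real.tendsto_exp_atBot.comp ?_)
    have h1 : Filter.Tendsto (fun x : Space d => ‖x‖ - ‖y‖) (Filter.cocompact _) Filter.atTop :=
      Filter.tendsto_atTop_add_const_right _ _ (tendsto_norm_cocompact_atTop)
    have h2 : Filter.Tendsto (fun x : Space d => ‖y - x‖) (Filter.cocompact _) Filter.atTop :=
      Filter.tendsto_atTop_mono (fun x => by rw [norm_sub_rev]; exact norm_sub_norm_le x y) h1
    have h3 := ((Filter.tendsto_pow_atTop two_ne_zero).comp h2)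
    have h4 := Filter.tendsto_neg_atTop_atBot.comp h3
    exact h4.atBot_div_const (by positivity)

/-- Coercivity, from which the smoothed potential gets a minimizer. -/
theorem tendsto_heatPotential_cocompact (hs : 0 < s) (hi : Integrable w) (hw : ∀ y, 0 < w y) :
    Filter.Tendsto (heatPotential s w) (Filter.cocompact (Space d)) Filter.atTop := by
  have h1 : Filter.Tendsto (heat s w) (Filter.cocompact (Space d)) (nhdsWithin 0 (Set.Ioi 0)) :=
    tendsto_nhdsWithin_iff.2 ⟨tendsto_heat_cocompact hs hi, .of_forall fun x => heat_pos hs hi hw x⟩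
  exact (Real.tendsto_log_nhdsGT_zero.comp h1).const_mul_atBot_of_neg (by linarith)

/-- This makes `deconv` finite. The mass that `w` puts near `p` alone bounds the heat below by a
multiple of `exp (-‖x - p‖² / (2 s))`. -/
theorem exists_heatPotential_sub_le (hs : 0 < s) (hi : Integrable w) (hw : ∀ y, 0 < w y)
    (hc : Continuous w) (p : Space d) :
    ∃ C, ∀ x, heatPotential s w x - ‖x - p‖ ^ 2 / 2 ≤ C := by
  obtain ⟨y₀, -, hy₀⟩ := (isCompact_closedBall p 2).exists_isMinOn (Metric.nonempty_closedBall.2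
    zero_le_two) hc.continuousOn
  set m := Real.exp (-(2 / s)) * w y₀ * (volume (Metric.ball (0 : Space d) 1)).toReal with hm
  have hvol : 0 < (volume (Metric.ball (0 : Space d) 1)).toReal :=
    ENNReal.toReal_pos (Metric.measure_ball_pos _ _ zero_lt_one).ne' measure_ball_lt_top.ne
  have hm0 : 0 < m := mul_pos (mul_pos (Real.exp_pos _) (hw _)) hvol
  refine ⟨-s * Real.log m, fun x => ?_⟩
  suffices h : m * Real.exp (-(‖x - p‖ ^ 2 / (2 * s))) ≤ heat s w x by
    have h1 := Real.log_le_log (mul_pos hm0 (Real.exp_pos _)) h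
    rw [Real.log_mul hm0.ne' (Real.exp_pos _).ne', Real.log_exp] at h1
    have h2 := mul_le_mul_of_nonneg_left h1 hs.le
    have h3 : s * (‖x - p‖ ^ 2 / (2 * s)) = ‖x - p‖ ^ 2 / 2 := by field_simp
    unfold heatPotential
    linarith
  -- `u` points from `p` towards `x` (and is 0 if `x = p`). The unit ball around `p + u` then lies
  -- in the half-space `⟨x - p, y - p⟩ ≥ 0`, where `‖y - x‖² ≤ 4 + ‖x - p‖²`; the 4 produces the
  -- constant `exp (-(2 / s))`.
  obtain ⟨u, hu1, hu2⟩ : ∃ u : Space d, ‖u‖ ≤ 1 ∧ inner ℝ (x - p) u = ‖x - p‖ := by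
    refine ⟨‖x - p‖⁻¹ • (x - p), ?_, ?_⟩
    · rw [norm_smul, norm_inv, norm_norm]
      exact inv_mul_le_one
    · rw [inner_smul_right, real_inner_self_eq_norm_sq]
      rcases eq_or_ne ‖x - p‖ 0 with h | h
      · simp [h]
      · field_simp
  have hball : ∀ y ∈ Metric.ball (p + u) 1, Real.exp (-(2 / s)) * w y₀ *
      Real.exp (-(‖x - p‖ ^ 2 / (2 * s))) ≤ Real.exp (-‖y - x‖ ^ 2 / (2 * s)) * w y := by
    intro y hy
    rw [Metric.mem_ball, dist_eq_norm] at hy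
    have h1 : ‖y - p‖ ≤ 2 := by
      have : y - p = (y - (p + u)) + u := by abel
      rw [this]
      exact (norm_add_le _ _).trans (by linarith)
    have h2 : w y₀ ≤ w y := hy₀ (by rwa [Metric.mem_closedBall, dist_eq_norm])
    have h3 : 0 ≤ inner ℝ (x - p) (y - p) := by
      have : y - p = u + (y - (p + u)) := by abel
      rw [this, inner_add_right, hu2]
      have := neg_le_of_abs_le (abs_real_inner_le_norm (x - p) (y - (p + u)))
      nlinarith [norm_nonneg (x - p)]
    have h4 : ‖y - x‖ ^ 2 = ‖y - p‖ ^ 2 - 2 * inner ℝ (x - p) (y - p) + ‖x - p‖ ^ 2 := by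
      rw [real_inner_comm, ← norm_sub_sq_real, sub_sub_sub_cancel_right]
    have h5 : ‖y - x‖ ^ 2 ≤ 4 + ‖x - p‖ ^ 2 := by nlinarith [norm_nonneg (y - p)]
    have h6 : Real.exp (-(2 / s)) * Real.exp (-(‖x - p‖ ^ 2 / (2 * s))) ≤
        Real.exp (-‖y - x‖ ^ 2 / (2 * s)) := by
      rw [← Real.exp_add, Real.exp_le_exp]
      have : -(2 / s) + -(‖x - p‖ ^ 2 / (2 * s)) = -(4 + ‖x - p‖ ^ 2) / (2 * s) := by
        field_simp; ring
      rw [this]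
      exact div_le_div_of_nonneg_right (by linarith) (by positivity)
    calc _ = (Real.exp (-(2 / s)) * Real.exp (-(‖x - p‖ ^ 2 / (2 * s)))) * w y₀ := by ring
      _ ≤ _ := mul_le_mul h6 h2 (hw _).le (Real.exp_pos _).le
  have hint := integrable_heat hs hi x
  have h1 := setIntegral_mono_on (μ := volume) (integrableOn_const (C := Real.exp (-(2 / s)) * w y₀ *
      Real.exp (-(‖x - p‖ ^ 2 / (2 * s)))) measure_ball_lt_top.ne) hint.integrableOn
    Metric.isOpen_ball.measurableSet hball
  have h2 := setIntegral_le_integral (s := Metric.ball (p + u) 1) hint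
    (.of_forall fun y => (mul_pos (Real.exp_pos _) (hw y)).le)
  refine le_trans (le_of_eq ?_) (h1.trans h2)
  rw [setIntegral_const, smul_eq_mul, hm, Measure.real,
    Measure.addHaar_ball_center volume (p + u) 1]
  ring

/-- Gaussian smoothing preserves log-concavity. -/
theorem convexOn_heatPotential_of_convexOn (hs : 0 < s) {φ : Space d → ℝ}
    (hφ : ConvexOn ℝ Set.univ φ) (hc : Continuous φ) (hi : Integrable fun y => Real.exp (-φ y)) :
    ConvexOn ℝ Set.univ (heatPotential s fun y => Real.exp (-φ y)) := by
  set w : Space d → ℝ := fun y => Real.exp (-φ y) with hwdef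
  have hw : ∀ y, 0 < w y := fun y => Real.exp_pos _
  rw [convexOn_iff_forall_pos]
  refine ⟨convex_univ, fun x _ x' _ a t ha ht hat => ?_⟩
  obtain rfl : a = 1 - t := by linarith
  have ht1 : t < 1 := by linarith
  have hl : ∀ x, ∫⁻ y, ENNReal.ofReal (Real.exp (-‖y - x‖ ^ 2 / (2 * s)) * w y)
      = ENNReal.ofReal (heat s w x) := fun x =>
    (ofReal_integral_eq_lintegral_ofReal (integrable_heat hs hi x)
      (.of_forall fun y => (mul_pos (Real.exp_pos _) (hw y)).le)).symm
  have hmeas : ∀ x, Measurable fun y =>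
      ENNReal.ofReal (Real.exp (-‖y - x‖ ^ 2 / (2 * s)) * w y) := by
    intro x
    have : Continuous w := by fun_prop
    have : Continuous fun y => Real.exp (-‖y - x‖ ^ 2 / (2 * s)) * w y := by fun_prop
    exact this.measurable.ennreal_ofReal
  -- The pointwise hypothesis is joint convexity of `‖y - x‖² / (2 s) + φ y` in `(x, y)`.
  have key := prekopaLeindler ht ht1 (hmeas x) (hmeas x') (hmeas ((1 - t) • x + t • x')) ?_
  · rw [hl, hl, hl, ENNReal.ofReal_rpow_of_pos (heat_pos hs hi hw x),
      ENNReal.ofReal_rpow_of_pos (heat_pos hs hi hw x'), ← ENNReal.ofReal_mul (by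
        exact (Real.rpow_pos_of_pos (heat_pos hs hi hw x) _).le),
      ENNReal.ofReal_le_ofReal_iff (heat_pos hs hi hw _).le] at key
    have p1 := Real.rpow_pos_of_pos (heat_pos hs hi hw x) (1 - t)
    have p2 := Real.rpow_pos_of_pos (heat_pos hs hi hw x') t
    have h1 := Real.log_le_log (mul_pos p1 p2) key
    rw [Real.log_mul p1.ne' p2.ne', Real.log_rpow (heat_pos hs hi hw x),
      Real.log_rpow (heat_pos hs hi hw x')] at h1
    have h2 := mul_le_mul_of_nonneg_left h1 hs.le
    unfold heatPotential
    simp only [smul_eq_mul]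
    linarith
  · intro y y'
    rw [ENNReal.ofReal_rpow_of_pos (mul_pos (Real.exp_pos _) (hw y)),
      ENNReal.ofReal_rpow_of_pos (mul_pos (Real.exp_pos _) (hw y')), ← ENNReal.ofReal_mul (by
        exact (Real.rpow_pos_of_pos (mul_pos (Real.exp_pos _) (hw y)) _).le)]
    refine ENNReal.ofReal_le_ofReal ?_
    simp only [hwdef]
    rw [← Real.exp_add, ← Real.exp_add, ← Real.exp_add, ← Real.exp_mul, ← Real.exp_mul,
      ← Real.exp_add, Real.exp_le_exp]
    have h1 := hφ.2 (Set.mem_univ y) (Set.mem_univ y') ha.le ht.le hat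
    simp only [smul_eq_mul] at h1
    have e : (1 - t) • y + t • y' - ((1 - t) • x + t • x')
        = (1 - t) • (y - x) + t • (y' - x') := by module
    have h2 : ‖(1 - t) • (y - x) + t • (y' - x')‖ ^ 2
        ≤ (1 - t) * ‖y - x‖ ^ 2 + t * ‖y' - x'‖ ^ 2 := by
      have h3 := sq_nonneg ‖(y - x) - (y' - x')‖
      rw [norm_sub_sq_real] at h3
      rw [norm_add_sq_real, norm_smul, norm_smul, inner_smul_left, inner_smul_right,
        Real.norm_of_nonneg ha.le, Real.norm_of_nonneg ht.le]
      simp only [conj_trivial]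
      nlinarith [mul_nonneg (mul_pos ha ht).le h3]
    rw [e]
    have h4 : -((1 - t) * ‖y - x‖ ^ 2 + t * ‖y' - x'‖ ^ 2) / (2 * s) ≤
        -‖(1 - t) • (y - x) + t • (y' - x')‖ ^ 2 / (2 * s) :=
      div_le_div_of_nonneg_right (by linarith) (by positivity)
    have h5 : -((1 - t) * ‖y - x‖ ^ 2 + t * ‖y' - x'‖ ^ 2) / (2 * s) =
        -‖y - x‖ ^ 2 / (2 * s) * (1 - t) + -‖y' - x'‖ ^ 2 / (2 * s) * t := by ring
    linarith

end Heat

/-! ### Convexity for bounded perturbations of a quadratic -/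

section BoundedPerturbation

open MeasureTheory ProbabilityTheory

variable {d : ℕ}

theorem integral_gaussian_inner_sq {σ : ℝ} (hσ : 0 < σ) (m u : Space d) :
    ∫ y, Real.exp (-‖y - m‖ ^ 2 / (2 * σ)) * inner ℝ u (y - m) ^ 2 =
      σ * ‖u‖ ^ 2 * ∫ y, Real.exp (-‖y - m‖ ^ 2 / (2 * σ)) := by
  have hS : (σ • (1 : Matrix (Fin d) (Fin d) ℝ)).PosSemidef := Matrix.PosSemidef.one.smul hσ.le
  have : IsProbabilityMeasure (isoGaussian m σ) := by unfold isoGaussian; infer_instance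
  have hL : MemLp id 2 (isoGaussian m σ) := by
    unfold isoGaussian; exact IsGaussian.memLp_two_id
  have hmean : ∫ y, inner ℝ u y ∂(isoGaussian m σ) = inner ℝ u m := by
    have hI : Integrable (fun y : Space d => y) (isoGaussian m σ) := hL.integrable one_le_two
    rw [integral_inner hI, isoGaussian, integral_id_multivariateGaussian]
  have hvar : Var[fun y => inner ℝ u y; isoGaussian m σ] = σ * ‖u‖ ^ 2 := by
    rw [← covarianceBilin_self hL, isoGaussian, covarianceBilin_multivariateGaussian hS,
      Matrix.smul_mulVec, Matrix.one_mulVec, dotProduct_smul, EuclideanSpace.norm_sq_eq]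
    simp [dotProduct, sq]
  rw [variance_eq_integral (by fun_prop), hmean, integral_isoGaussian m hσ] at hvar
  have h1 : ∫ _, (1 : ℝ) ∂(isoGaussian m σ) = 1 := by simp
  rw [integral_isoGaussian m hσ] at h1
  set c := ((2 * Real.pi * σ) ^ ((d : ℝ) / 2))⁻¹ with hc
  have hc0 : c ≠ 0 := by positivity
  simp only [smul_eq_mul, mul_one, ← inner_sub_right] at hvar h1
  refine mul_left_cancel₀ hc0 ?_
  rw [hvar, mul_left_comm, h1, mul_one]

theorem integrable_gaussian_inner_sq {σ : ℝ} (hσ : 0 < σ) (m u : Space d) :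
    Integrable fun y => Real.exp (-‖y - m‖ ^ 2 / (2 * σ)) * inner ℝ u (y - m) ^ 2 := by
  rcases eq_or_ne u 0 with rfl | hu
  · simp
  · have h1 : ∫ _, (1 : ℝ) ∂(isoGaussian m σ) = 1 := by
      have : IsProbabilityMeasure (isoGaussian m σ) := by unfold isoGaussian; infer_instance
      simp
    rw [integral_isoGaussian m hσ] at h1
    simp only [smul_eq_mul, mul_one] at h1
    -- A Bochner integral of a non-integrable function is 0, so a nonzero value proves
    -- integrability; hence the separate case `u = 0`.
    refine .of_integral_ne_zero ?_
    rw [integral_gaussian_inner_sq hσ]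
    refine mul_ne_zero (mul_ne_zero hσ.ne' (pow_ne_zero 2 (norm_ne_zero_iff.2 hu))) fun h => ?_
    rw [h, mul_zero] at h1
    exact zero_ne_one h1

theorem integrable_gaussian {σ : ℝ} (hσ : 0 < σ) (m : Space d) :
    Integrable fun y => Real.exp (-‖y - m‖ ^ 2 / (2 * σ)) := by
  have h1 : ∫ _, (1 : ℝ) ∂(isoGaussian m σ) = 1 := by
    have : IsProbabilityMeasure (isoGaussian m σ) := by unfold isoGaussian; infer_instance
    simp
  rw [integral_isoGaussian m hσ] at h1
  simp only [smul_eq_mul, mul_one] at h1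
  refine .of_integral_ne_zero fun h => ?_
  rw [h, mul_zero] at h1
  exact zero_ne_one h1

variable {s k m₀ M₀ : ℝ} {w v : Space d → ℝ}

/-- Completing the square, kernel times quadratic part is a multiple of a Gaussian centered at `(1 +
k * s)⁻¹ • x` with variance `s / (1 + k * s)`. Replacing `v` by its bounds costs a factor `M₀ / m₀ ≤
1 + k * s`, exactly what brings the variance back to `s`. -/
theorem heat_second_moment_le (hs : 0 < s) (hk : 0 < k) (hi : Integrable w)
    (hwv : ∀ y, w y = Real.exp (-(k / 2 * ‖y‖ ^ 2)) * v y) (hm₀ : 0 < m₀)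
    (hv₁ : ∀ y, m₀ ≤ v y) (hv₂ : ∀ y, v y ≤ M₀) (hM : M₀ ≤ m₀ * (1 + k * s)) (x u : Space d) :
    ∫ y, Real.exp (-‖y - x‖ ^ 2 / (2 * s)) * w y * inner ℝ u (y - (1 + k * s)⁻¹ • x) ^ 2 ≤
      s * ‖u‖ ^ 2 * heat s w x := by
  set q := 1 + k * s with hq
  have hq0 : 0 < q := by positivity
  set m := q⁻¹ • x with hm
  set σ := s / q with hσ
  have hσ0 : 0 < σ := div_pos hs hq0
  set K := Real.exp (-‖x‖ ^ 2 / (2 * s) + ‖x‖ ^ 2 / (2 * s * q)) with hK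
  have hK0 : 0 < K := Real.exp_pos _
  have hsq : ∀ y, Real.exp (-‖y - x‖ ^ 2 / (2 * s)) * w y =
      K * Real.exp (-‖y - m‖ ^ 2 / (2 * σ)) * v y := by
    intro y
    rw [hwv, ← mul_assoc, ← Real.exp_add, ← Real.exp_add]
    congr 2
    rw [norm_sub_sq_real, norm_sub_sq_real, hm, inner_smul_right, norm_smul, mul_pow, hσ,
      Real.norm_of_nonneg (inv_pos.2 hq0).le]
    field_simp
    rw [hq]
    ring
  have hA : ∫ y, Real.exp (-‖y - x‖ ^ 2 / (2 * s)) * w y * inner ℝ u (y - m) ^ 2 ≤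
      K * M₀ * (σ * ‖u‖ ^ 2 * ∫ y, Real.exp (-‖y - m‖ ^ 2 / (2 * σ))) := by
    rw [← integral_gaussian_inner_sq hσ0, ← integral_const_mul]
    refine integral_mono_of_nonneg (.of_forall fun y => ?_)
      ((integrable_gaussian_inner_sq hσ0 m u).const_mul _) (.of_forall fun y => ?_)
    · simp only [hsq, Pi.zero_apply]
      have := hm₀.le.trans (hv₁ y)
      positivity
    · simp only [hsq]
      calc _ = K * (Real.exp (-‖y - m‖ ^ 2 / (2 * σ)) * inner ℝ u (y - m) ^ 2) * v y := by ring
        _ ≤ K * (Real.exp (-‖y - m‖ ^ 2 / (2 * σ)) * inner ℝ u (y - m) ^ 2) * M₀ :=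
            mul_le_mul_of_nonneg_left (hv₂ y) (by positivity)
        _ = _ := by ring
  have hB : K * m₀ * ∫ y, Real.exp (-‖y - m‖ ^ 2 / (2 * σ)) ≤ heat s w x := by
    rw [← integral_const_mul]
    refine integral_mono ((integrable_gaussian hσ0 m).const_mul _) (integrable_heat hs hi x)
      fun y => ?_
    simp only [hsq]
    calc _ = K * Real.exp (-‖y - m‖ ^ 2 / (2 * σ)) * m₀ := by ring
      _ ≤ _ := mul_le_mul_of_nonneg_left (hv₁ y) (by positivity)
  have hI : 0 ≤ ∫ y, Real.exp (-‖y - m‖ ^ 2 / (2 * σ)) :=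
    integral_nonneg fun y => (Real.exp_pos _).le
  refine hA.trans (le_trans ?_ (mul_le_mul_of_nonneg_left hB (by positivity)))
  have h1 : M₀ * σ ≤ m₀ * s := by
    rw [hσ, mul_div_assoc', div_le_iff₀ hq0]
    nlinarith
  have h2 := mul_le_mul_of_nonneg_left h1 (show 0 ≤ K * ‖u‖ ^ 2 *
    ∫ y, Real.exp (-‖y - m‖ ^ 2 / (2 * σ)) by positivity)
  linarith

/-- The finite measure with density `w` times a Gaussian centered at `x`. -/
noncomputable def heatMeasure (s : ℝ) (w : Space d → ℝ) (x : Space d) : Measure (Space d) :=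
  volume.withDensity fun y => ENNReal.ofReal (Real.exp (-‖y - x‖ ^ 2 / (2 * s)) * w y)

theorem integral_heatMeasure (hw : ∀ y, 0 < w y) (hc : Continuous w)
    (x : Space d) (g : Space d → ℝ) :
    ∫ y, g y ∂(heatMeasure s w x) = ∫ y, Real.exp (-‖y - x‖ ^ 2 / (2 * s)) * w y * g y := by
  rw [heatMeasure, integral_withDensity_eq_integral_toReal_smul (by fun_prop)
    (.of_forall fun _ => ENNReal.ofReal_lt_top)]
  refine integral_congr_ae (.of_forall fun y => ?_)
  simp only [smul_eq_mul]
  rw [ENNReal.toReal_ofReal (mul_pos (Real.exp_pos _) (hw y)).le]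

theorem exp_mul_exp_inner (hs : 0 < s) (x u y : Space d) (t : ℝ) :
    Real.exp (-‖y - x‖ ^ 2 / (2 * s)) * Real.exp (t * (inner ℝ u (y - x) / s)) =
      Real.exp (t ^ 2 * ‖u‖ ^ 2 / (2 * s)) * Real.exp (-‖y - (x + t • u)‖ ^ 2 / (2 * s)) := by
  rw [← Real.exp_add, ← Real.exp_add]
  congr 1
  rw [← sub_sub, norm_sub_sq_real (y - x), inner_smul_right, norm_smul, mul_pow,
    Real.norm_eq_abs, sq_abs, real_inner_comm]
  field_simp
  ring

/-- Moving the center along `u` is an exponential tilt, so the heat along a line is a moment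
generating function up to a Gaussian factor, and its log-derivatives are cumulants. -/
theorem mgf_heatMeasure (hs : 0 < s) (hw : ∀ y, 0 < w y) (hc : Continuous w)
    (x u : Space d) (t : ℝ) :
    mgf (fun y => inner ℝ u (y - x) / s) (heatMeasure s w x) t =
      Real.exp (t ^ 2 * ‖u‖ ^ 2 / (2 * s)) * heat s w (x + t • u) := by
  rw [mgf, integral_heatMeasure hw hc, heat, ← integral_const_mul]
  refine integral_congr_ae (.of_forall fun y => ?_)
  simp only []
  rw [mul_right_comm, exp_mul_exp_inner hs]
  ring

theorem integrableExpSet_heatMeasure (hs : 0 < s) (hi : Integrable w) (hw : ∀ y, 0 < w y)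
    (hc : Continuous w) (x u : Space d) :
    integrableExpSet (fun y => inner ℝ u (y - x) / s) (heatMeasure s w x) = Set.univ := by
  refine Set.eq_univ_of_forall fun t => ?_
  change Integrable _ _
  rw [heatMeasure, integrable_withDensity_iff_integrable_smul' (by fun_prop)
    (.of_forall fun _ => ENNReal.ofReal_lt_top)]
  refine ((integrable_heat hs hi (x + t • u)).const_mul
    (Real.exp (t ^ 2 * ‖u‖ ^ 2 / (2 * s)))).congr (.of_forall fun y => ?_)
  simp only [smul_eq_mul]
  rw [ENNReal.toReal_ofReal (mul_pos (Real.exp_pos _) (hw y)).le, mul_right_comm _ (w y),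
    exp_mul_exp_inner hs]
  ring

/-- The second derivative of the cumulant function is the variance under the tilted measure, at most
the second moment about any point. The reference Gaussian's center is used instead of the unknown
mean. -/
theorem iteratedDeriv_two_cgf_heatMeasure_le (hs : 0 < s) (hk : 0 < k) (hi : Integrable w)
    (hw : ∀ y, 0 < w y) (hc : Continuous w)
    (hwv : ∀ y, w y = Real.exp (-(k / 2 * ‖y‖ ^ 2)) * v y) (hm₀ : 0 < m₀)
    (hv₁ : ∀ y, m₀ ≤ v y) (hv₂ : ∀ y, v y ≤ M₀) (hM : M₀ ≤ m₀ * (1 + k * s)) (x u : Space d)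
    (t : ℝ) :
    s * iteratedDeriv 2 (cgf (fun y => inner ℝ u (y - x) / s) (heatMeasure s w x)) t ≤
      ‖u‖ ^ 2 := by
  set X : Space d → ℝ := fun y => inner ℝ u (y - x) / s with hX
  have hset : t ∈ interior (integrableExpSet X (heatMeasure s w x)) := by
    rw [integrableExpSet_heatMeasure hs hi hw hc, interior_univ]; trivial
  have hset' : Integrable (fun y => Real.exp (t * X y)) (heatMeasure s w x) := by
    have : t ∈ integrableExpSet X (heatMeasure s w x) := interior_subset hset
    exact this
  have hmgf := mgf_heatMeasure hs hw hc x u t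
  have hmgf0 : 0 < mgf X (heatMeasure s w x) t := by
    rw [hmgf]; exact mul_pos (Real.exp_pos _) (heat_pos hs hi hw _)
  have : NeZero (heatMeasure s w x) := by
    refine ⟨fun h => ?_⟩
    rw [h, mgf_zero_measure] at hmgf0
    exact lt_irrefl _ hmgf0
  have : IsProbabilityMeasure ((heatMeasure s w x).tilted fun y => t * X y) :=
    isProbabilityMeasure_tilted hset'
  have hXc : Continuous X := by fun_prop
  set z := x + t • u with hz
  set p := (1 + k * s)⁻¹ • z with hp
  set a := inner ℝ u (p - x) / s with ha
  have h1 : iteratedDeriv 2 (cgf X (heatMeasure s w x)) t ≤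
      ∫ y, (X y - a) ^ 2 ∂((heatMeasure s w x).tilted fun y => t * X y) := by
    rw [← variance_tilted_mul hset, ← variance_sub_const hXc.aestronglyMeasurable a]
    exact variance_le_expectation_sq (by fun_prop)
  have h2 : ∫ y, (X y - a) ^ 2 ∂((heatMeasure s w x).tilted fun y => t * X y) =
      (s ^ 2)⁻¹ * (heat s w z)⁻¹ *
        ∫ y, Real.exp (-‖y - z‖ ^ 2 / (2 * s)) * w y * inner ℝ u (y - p) ^ 2 := by
    rw [integral_tilted, integral_heatMeasure hw hc, ← integral_const_mul]
    refine integral_congr_ae (.of_forall fun y => ?_)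
    have e1 : X y - a = inner ℝ u (y - p) / s := by
      rw [hX, ha, ← sub_div, ← inner_sub_right, sub_sub_sub_cancel_right]
    have e2 : ∫ y, Real.exp (t * X y) ∂(heatMeasure s w x) =
      Real.exp (t ^ 2 * ‖u‖ ^ 2 / (2 * s)) * heat s w z := hmgf
    simp only [smul_eq_mul]
    rw [e1, e2]
    have e3 := exp_mul_exp_inner hs x u y t
    have e4 := heat_pos hs hi hw z
    have e5 := Real.exp_pos (t ^ 2 * ‖u‖ ^ 2 / (2 * s))
    calc _ = (Real.exp (-‖y - x‖ ^ 2 / (2 * s)) * Real.exp (t * (inner ℝ u (y - x) / s))) * w y *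
          (inner ℝ u (y - p) / s) ^ 2 / (Real.exp (t ^ 2 * ‖u‖ ^ 2 / (2 * s)) * heat s w z) := by
          ring
      _ = _ := by
          rw [e3, ← hz]
          field_simp
  have h3 := heat_second_moment_le hs hk hi hwv hm₀ hv₁ hv₂ hM z u
  have h4 := heat_pos hs hi hw z
  calc _ ≤ s * ((s ^ 2)⁻¹ * (heat s w z)⁻¹ * (s * ‖u‖ ^ 2 * heat s w z)) := by
        refine mul_le_mul_of_nonneg_left (h1.trans (h2.le.trans ?_)) hs.le
        exact mul_le_mul_of_nonneg_left h3 (by positivity)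
    _ = _ := by field_simp

theorem convexOn_of_convexOn_lines {G : Space d → ℝ}
    (h : ∀ x u, ConvexOn ℝ Set.univ fun t : ℝ => G (x + t • u)) : ConvexOn ℝ Set.univ G := by
  refine ⟨convex_univ, fun x _ y _ a b ha hb hab => ?_⟩
  have := (h x (y - x)).2 (Set.mem_univ 0) (Set.mem_univ 1) ha hb hab
  have e : x + b • (y - x) = a • x + b • y := by
    rw [show a = 1 - b by linarith]; module
  simpa [e] using this

/-- The smoothed potential of a quadratic perturbed by a function of small oscillation is
convex. -/
theorem convexOn_heatPotential_of_perturbation (hs : 0 < s) (hk : 0 < k) (hi : Integrable w)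
    (hw : ∀ y, 0 < w y) (hc : Continuous w)
    (hwv : ∀ y, w y = Real.exp (-(k / 2 * ‖y‖ ^ 2)) * v y) (hm₀ : 0 < m₀)
    (hv₁ : ∀ y, m₀ ≤ v y) (hv₂ : ∀ y, v y ≤ M₀) (hM : M₀ ≤ m₀ * (1 + k * s)) :
    ConvexOn ℝ Set.univ (heatPotential s w) := by
  refine convexOn_of_convexOn_lines fun x u => ?_
  set c := cgf (fun y => inner ℝ u (y - x) / s) (heatMeasure s w x) with hcgf
  have han : ∀ t, AnalyticAt ℝ c t := fun t => analyticAt_cgf (by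
    rw [integrableExpSet_heatMeasure hs hi hw hc, interior_univ]; trivial)
  -- Along the line, convexity amounts to `s * c'' ≤ ‖u‖²`.
  have e : (fun t : ℝ => heatPotential s w (x + t • u)) =
      fun t => t ^ 2 * (‖u‖ ^ 2 / 2) - s * c t := by
    ext t
    rw [hcgf, cgf, mgf_heatMeasure hs hw hc, Real.log_mul (Real.exp_pos _).ne'
      (heat_pos hs hi hw _).ne', Real.log_exp, heatPotential]
    field_simp
    ring
  rw [e]
  have d1 : ∀ t, HasDerivAt (fun t => t ^ 2 * (‖u‖ ^ 2 / 2) - s * c t)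
      (t * ‖u‖ ^ 2 - s * deriv c t) t := by
    intro t
    have h1 := ((hasDerivAt_pow 2 t).mul_const (‖u‖ ^ 2 / 2)).sub
      ((han t).differentiableAt.hasDerivAt.const_mul s)
    refine h1.congr_deriv ?_
    push_cast
    ring
  have d2 : ∀ t, HasDerivAt (fun t => t * ‖u‖ ^ 2 - s * deriv c t)
      (‖u‖ ^ 2 - s * iteratedDeriv 2 c t) t := by
    intro t
    have h1 := ((hasDerivAt_id t).mul_const (‖u‖ ^ 2)).sub
      ((han t).deriv.differentiableAt.hasDerivAt.const_mul s)
    rw [iteratedDeriv_succ, iteratedDeriv_one]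
    exact h1.congr_deriv (by ring)
  have hd : deriv (fun t => t ^ 2 * (‖u‖ ^ 2 / 2) - s * c t) =
      fun t => t * ‖u‖ ^ 2 - s * deriv c t := funext fun t => (d1 t).deriv
  refine convexOn_univ_of_deriv2_nonneg (fun t => (d1 t).differentiableAt) ?_ fun t => ?_
  · rw [hd]; exact fun t => (d2 t).differentiableAt
  · rw [Function.iterate_succ_apply, Function.iterate_one, hd, (d2 t).deriv, sub_nonneg]
    exact iteratedDeriv_two_cgf_heatMeasure_le hs hk hi hw hc hwv hm₀ hv₁ hv₂ hM x u t

end BoundedPerturbation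

/-! ### Translation to the soft Moreau envelope and conclusion -/

variable {d : ℕ} {lam δ : ℝ} {f : Space d → ℝ}

theorem integrable_weight_of_standing (hf : StandingAssumption f δ) :
    MeasureTheory.Integrable fun y => Real.exp (-(f y / δ)) := by
  simpa only [neg_div] using hf.integrable

theorem softMoreau_eq (hlam : 0 < lam) (hδ : 0 < δ) (hf : StandingAssumption f δ) (x : Space d) :
    softMoreau lam δ f x = -δ * Real.log ((2 * Real.pi * (lam * δ)) ^ ((d : ℝ) / 2))⁻¹ +
      lam⁻¹ * heatPotential (lam * δ) (fun y => Real.exp (-(f y / δ))) x := by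
  have hs : 0 < lam * δ := mul_pos hlam hδ
  rw [softMoreau, integral_isoGaussian x hs, heatPotential]
  simp only [smul_eq_mul, neg_div _ (f _)]
  have hp := heat_pos hs (integrable_weight_of_standing hf) (fun y => Real.exp_pos _) x
  rw [Real.log_mul (by positivity) (by exact hp.ne')]
  unfold heat
  field_simp
  ring

theorem zprox_eq (hlam : 0 < lam) (hδ : 0 < δ) (x : Space d) :
    zprox lam δ f x = heatMean (lam * δ) (fun y => Real.exp (-(f y / δ))) x := by
  have hs : 0 < lam * δ := mul_pos hlam hδ
  rw [zprox, integral_isoGaussian x hs, integral_isoGaussian x hs, heatMean, heat]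
  simp only [smul_smul, smul_eq_mul, neg_div _ (f _)]
  congr 1
  have : 0 < (2 * Real.pi * (lam * δ)) ^ ((d : ℝ) / 2) := by positivity
  rw [mul_inv, mul_right_comm, inv_mul_cancel₀ (by positivity), one_mul]

theorem convexOn_heatPotential (hlam : 0 < lam) (hδ : 0 < δ) (hf : StandingAssumption f δ)
    (hcase : ConvexOn ℝ Set.univ f ∨ BoundedOscillation lam δ f) :
    ConvexOn ℝ Set.univ (heatPotential (lam * δ) fun y => Real.exp (-(f y / δ))) := by
  have hs : 0 < lam * δ := mul_pos hlam hδ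
  have hi := integrable_weight_of_standing hf
  rcases hcase with hconv | ⟨κ, V, hκ, hfV, hVa, hVb, hosc⟩
  · refine convexOn_heatPotential_of_convexOn hs (φ := fun y => f y / δ) ?_
      (hf.continuous.div_const δ) hi
    simpa [div_eq_inv_mul] using hconv.smul (inv_pos.2 hδ).le
  · refine convexOn_heatPotential_of_perturbation (k := κ / δ) (v := fun y => Real.exp (-(V y / δ)))
      (m₀ := Real.exp (-((⨆ y, V y) / δ))) (M₀ := Real.exp (-((⨅ y, V y) / δ)))
      hs (div_pos hκ hδ) hi (fun y => Real.exp_pos _)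
      (Real.continuous_exp.comp (hf.continuous.div_const δ).neg) (fun y => ?_) (Real.exp_pos _)
      (fun y => ?_) (fun y => ?_) ?_
    · rw [← Real.exp_add, hfV]
      congr 1
      ring
    · exact Real.exp_le_exp.2 (neg_le_neg (div_le_div_of_nonneg_right (le_ciSup hVa y) hδ.le))
    · exact Real.exp_le_exp.2 (neg_le_neg (div_le_div_of_nonneg_right (ciInf_le hVb y) hδ.le))
    -- Here `M₀ / m₀ = exp (osc V / δ)` and `k * s = lam * κ`, so the required ratio bound is
    -- exactly the oscillation condition.
    · rw [div_le_iff₀ hκ] at hosc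
      have e : κ / δ * (lam * δ) = lam * κ := by field_simp
      have e2 : Real.exp (-((⨅ y, V y) / δ)) =
          Real.exp (-((⨆ y, V y) / δ)) * Real.exp (osc V / δ) := by
        rw [← Real.exp_add, osc]
        congr 1
        ring
      rw [e, e2]
      exact mul_le_mul_of_nonneg_left (by linarith) (Real.exp_pos _).le

end ZerothOrderProx

theorem mainTheorem6 {d : ℕ} (lam δ : ℝ) (hlam : 0 < lam) (hδ : 0 < δ)
    (f : ZerothOrderProx.Space d → ℝ)
    (hf : ZerothOrderProx.StandingAssumption f δ)
    (hcase : ConvexOn ℝ Set.univ f ∨ ZerothOrderProx.BoundedOscillation lam δ f) :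
    (∃ H : ZerothOrderProx.Space d → ℝ, ConvexOn ℝ Set.univ H ∧
      ∀ x, ZerothOrderProx.proxSet (lam * δ) H x = {ZerothOrderProx.zprox lam δ f x}) ∧
    ZerothOrderProx.FirmlyNonexpansive (ZerothOrderProx.zprox lam δ f) ∧
    Differentiable ℝ (ZerothOrderProx.softMoreau lam δ f) ∧
    ∀ x : ℕ → ZerothOrderProx.Space d,
      (∀ k, x (k + 1) = ZerothOrderProx.zprox lam δ f (x k)) →
      (∃ xstar ∈ ZerothOrderProx.argminSet (ZerothOrderProx.softMoreau lam δ f),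
        Filter.Tendsto x Filter.atTop (nhds xstar)) ∧
      ∀ k : ℕ, 1 ≤ k →
        ZerothOrderProx.softMoreau lam δ f (x k) - (⨅ y, ZerothOrderProx.softMoreau lam δ f y) ≤
          Metric.infDist (x 0)
            (ZerothOrderProx.argminSet (ZerothOrderProx.softMoreau lam δ f)) ^ 2 /
            (2 * lam * k) ∧
        ‖gradient (ZerothOrderProx.softMoreau lam δ f) (x k)‖ ≤
          2 * Metric.infDist (x 0)
            (ZerothOrderProx.argminSet (ZerothOrderProx.softMoreau lam δ f)) /
            (lam * (k + 1)) := by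
  open ZerothOrderProx in
  have hs : 0 < lam * δ := mul_pos hlam hδ
  set w : Space d → ℝ := fun y => Real.exp (-(f y / δ)) with hwdef
  have hw : ∀ y, 0 < w y := fun y => Real.exp_pos _
  have hc : Continuous w := Real.continuous_exp.comp (hf.continuous.div_const δ).neg
  have hi : MeasureTheory.Integrable w := integrable_weight_of_standing hf
  have hTe : zprox lam δ f = heatMean (lam * δ) w := funext fun x => zprox_eq hlam hδ x
  have hFe := softMoreau_eq hlam hδ hf
  rw [hTe]
  set F := softMoreau lam δ f with hF
  set G := heatPotential (lam * δ) w with hGdef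
  set T := heatMean (lam * δ) w with hTdef
  have hG : ConvexOn ℝ Set.univ G := convexOn_heatPotential hlam hδ hf hcase
  have hT : ∀ x y, G y ≤ G x + inner ℝ (x - T x) (y - x) + ‖y - x‖ ^ 2 / 2 :=
    heatPotential_le hs hi hw
  have hB : ∀ p, ∃ C, ∀ x, G x - ‖x - p‖ ^ 2 / 2 ≤ C := exists_heatPotential_sub_le hs hi hw hc
  have hgrad : ∀ x, HasGradientAt F (lam⁻¹ • (x - T x)) x := by
    intro x
    have h1 := (hasGradientAt_of_convexOn hG hT x).hasFDerivAt
    have h2 := (h1.const_mul lam⁻¹).const_add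
      (-δ * Real.log ((2 * Real.pi * (lam * δ)) ^ ((d : ℝ) / 2))⁻¹)
    rw [hasGradientAt_iff_hasFDerivAt, map_smul, funext hFe]
    exact h2
  have hargmin : argminSet F = argminSet G := by
    ext x
    refine forall_congr' fun y => ?_
    rw [hFe, hFe, add_le_add_iff_left, mul_le_mul_iff_right₀ (inv_pos.2 hlam)]
  have hcont : Continuous G := continuous_iff_continuousAt.2 fun y =>
    (hasGradientAt_of_convexOn hG hT y).continuousAt
  obtain ⟨p, hp⟩ : ∃ p, p ∈ argminSet G :=
    hcont.exists_forall_le (tendsto_heatPotential_cocompact hs hi hw)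
  have hclosed : IsClosed (argminSet G) := by
    have : argminSet G = ⋂ y, {x | G x ≤ G y} := by
      ext x; simp [argminSet]
    rw [this]
    exact isClosed_iInter fun y => isClosed_le hcont continuous_const
  refine ⟨⟨fun p => (lam * δ)⁻¹ * deconv G p, ?_, proxSet_deconv hs hG hT hB⟩,
    firmlyNonexpansive_of_convexOn hG hT, fun x => (hgrad x).differentiableAt, fun x hx => ⟨?_, ?_⟩⟩
  · simpa using (convexOn_deconv hG hB).smul (inv_pos.2 hs).le
  · rw [hargmin]
    exact exists_tendsto hG hT hx hp
  · intro k hk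
    have hk' : (0 : ℝ) < k := by exact_mod_cast hk
    rw [hargmin]
    -- The distance to the closed set of minimizers is attained, so the bounds for one minimizer
    -- give those with `infDist`.
    obtain ⟨q, hq, hqd⟩ := hclosed.exists_infDist_eq_dist ⟨p, hp⟩ (x 0)
    rw [hqd, dist_eq_norm]
    constructor
    · have hqF : q ∈ argminSet F := hargmin ▸ hq
      have hinf : ⨅ y, F y = F q :=
        le_antisymm (ciInf_le ⟨F q, by rintro _ ⟨y, rfl⟩; exact hqF y⟩ q) (le_ciInf hqF)
      rw [hinf, hFe, hFe, add_sub_add_left_eq_sub, ← mul_sub, le_div_iff₀ (by positivity)]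
      have h1 := gap_le hG hT hx q k
      calc _ = 2 * (k * (G (x k) - G q)) := by field_simp
        _ ≤ _ := by linarith
    · rw [(hgrad (x k)).gradient, norm_smul, norm_inv, Real.norm_of_nonneg hlam.le]
      have h1 := residual_le hG hT hx hq hk
      calc _ ≤ lam⁻¹ * (2 * ‖x 0 - q‖ / (k + 1)) :=
            mul_le_mul_of_nonneg_left h1 (inv_pos.2 hlam).le
        _ = _ := by field_simp
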